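/- Let $A\in\mathbb{R}^{n\times n}$ be a non-singular tridiagonal matrix ($a_{ij}=0$ if $|i-j|>1$), and let $X=A^{-1}$. Entries are numbered from $1$; entries of $A$ outside the matrix are read as $0$. Define extended real numbers $q_k,\hat r_k$ ($2\le k\le n$) and $\hat q_k,r_k$ ($1\le k\le n-1$) by $$q_2=-a_{1,1}^{-1}a_{2,1},\quad q_{k+1}=-s_k^{-1}a_{k+1,k},\quad \hat r_2=-a_{1,1}^{-1}a_{1,2},\quad \hat r_{k+1}=-s_k^{-1}a_{k,k+1},\quad s_k=a_{k,k}+a_{k-1,k}q_k\quad(1<k<n),$$ $$\hat q_{n-1}=-a_{n,n}^{-1}a_{n-1,n},\quad \hat q_{k-1}=-t_k^{-1}a_{k-1,k},\quad r_{n-1}=-a_{n,n}^{-1}a_{n,n-1},\quad r_{k-1}=-t_k^{-1}a_{k,k-1},\quad t_k=a_{k,k}+a_{k,k+1}r_k\quad(n>k>1),$$ with the convention $c/0=\infty$ for $c>0$, $c/0=-\infty$ for $c<0$, and $c/(\pm\infty)=0$ for finite $c$. No indeterminate expression $0/0$ or $0\cdot\infty$ occurs in these recurrences, and the following holds; in particular,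 in every formula of (a)-(c) that applies, the inverted entries of $A$ are non-zero and $\hat r_k$ in (b) is finite, and every entry of $A$ or $X$ in an applicable formula lies inside the matrix, except that the terms $a_{k-2,k-1}q_{k-1}$ (in (b), for $k=2$) and $a_{0,1}q_1$ (in the start $x_{n,n}$ below, for $n=1$) are read as $0$. **(a)** Let $2\le k\le n$. If $|q_k|<\infty$, then $x_{s,k-1}=q_k\,x_{s,k}$ for $k\le s\le n$. If $|q_k|=\infty$, then: if $k=n$, $x_{n,n-1}=a_{n-1,n}^{-1}$; if $k<n$, $x_{s,k-1}=-a_{k+1,k}a_{k-1,k}^{-1}x_{s,k+1}$ for $k<s\le n$, and $$x_{k,k-1}=\begin{cases} r_k^{-1}x_{k+1,k-1} & \text{if } r_k\ne0,\\ -a_{k+1,k+2}a_{k+1,k}^{-1}x_{k+2,k-1} & \text{if } r_k=0,\ a_{k+1,k}\neq0,\\ -a_{k,k+1}a_{k-1,k}^{-1}\hat q_k^{-1}x_{k+1,k+1} & \text{if } r_k=0,\ a_{k+1,k}=0,\ \hat q_k\ne0,\\ a_{k+1,k+2}a_{k-1,k}^{-1}x_{k+2,k+1} & \text{if } r_k=0,\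 a_{k+1,k}=0,\ \hat q_k=0,\ a_{k,k+1}\ne0,\\ a_{k-1,k}^{-1} & \text{otherwise.}\end{cases}$$ **(b)** For $2\le k\le n$, $$x_{k-1,k-1}=\begin{cases} r_{k-1}^{-1}x_{k,k-1} & \text{if } r_{k-1}\ne0,\\ \hat r_k\hat q_{k-1}^{-1}x_{k,k} & \text{if } r_{k-1}=0,\ \hat q_{k-1}\ne0,\\ -a_{k,k+1}a_{k,k-1}^{-1}x_{k+1,k-1} & \text{if } r_{k-1}=0,\ \hat q_{k-1}=0,\ a_{k,k-1}\ne0,\\ -a_{k,k+1}a_{k-1,k}^{-1}\hat r_k\,x_{k+1,k} & \text{if } r_{k-1}=0,\ \hat q_{k-1}=0,\ a_{k,k-1}=0,\ a_{k-1,k}\ne0,\\ (a_{k-2,k-1}q_{k-1}+a_{k-1,k-1})^{-1} & \text{otherwise.}\end{cases}$$ **(c)** Let $1\le k\le n-1$. If $|\hat q_k|<\infty$, then $x_{s,k+1}=\hat q_k\,x_{s,k}$ for $1\le s\le k$. If $|\hat q_k|=\infty$, then: if $k=1$, $x_{1,2}=a_{1,2}a_{2,1}^{-1}x_{2,1}$;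 if $k>1$, $x_{s,k+1}=-a_{k-1,k}a_{k+1,k}^{-1}x_{s,k-1}$ for $1\le s<k$, and $$x_{k,k+1}=\begin{cases} \hat r_k^{-1}x_{k-1,k+1} & \text{if } \hat r_k\ne0,\\ -a_{k-1,k-2}a_{k-1,k}^{-1}x_{k-2,k+1} & \text{if } \hat r_k=0,\ a_{k-1,k}\neq0,\\ -a_{k,k-1}a_{k+1,k}^{-1}q_k^{-1}x_{k-1,k-1} & \text{if } \hat r_k=0,\ a_{k-1,k}=0,\ q_k\ne0,\\ a_{k-1,k-2}a_{k+1,k}^{-1}x_{k-2,k-1} & \text{if } \hat r_k=0,\ a_{k-1,k}=0,\ q_k=0,\ a_{k,k-1}\ne0,\\ a_{k,k+1}a_{k+1,k}^{-1}x_{k+1,k} & \text{otherwise.}\end{cases}$$ **(d)** Consider the algorithm that computes the ratios by the recurrences, sets $x_{n,n}=(a_{n-1,n}q_n+a_{n,n})^{-1}$, computes for $k=n,n-1,\dots,2$ the elements $x_{s,k-1}$ ($k\le s\le n$) by (a) and then $x_{k-1,k-1}$ by (b), and finally computes for $k=1,\dots,n-1$ the elements $x_{s,k+1}$ ($1\le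 s\le k$) by (c), where the coefficient in each formula is computed once for all $s$. There is an absolute constant $C$ such that for every $n\ge1$ and every non-singular tridiagonal $A\in\mathbb{R}^{n\times n}$ this algorithm outputs $A^{-1}$ after at most $n^2+Cn$ operations (exact arithmetic operations on extended real numbers, and tests whether a number is zero or infinite). -/

import Mathlib

namespace TridiagInv

/-- `A` is tridiagonal: `a_{ij} = 0` whenever `|i - j| > 1`. -/
def IsTridiagonal {n : ℕ} (A : Matrix (Fin n) (Fin n) ℝ) : Prop :=
  ∀ i j : Fin n, 1 < |(i : ℤ) - (j : ℤ)| → A i j = 0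

/-- The entry in row `i` and column `j` of `M`, with rows and columns numbered `1, …, n`;
entries outside the matrix are `0`. -/
def entry {n : ℕ} (M : Matrix (Fin n) (Fin n) ℝ) (i j : ℕ) : ℝ :=
  if h : (1 ≤ i ∧ i ≤ n) ∧ (1 ≤ j ∧ j ≤ n) then
    M ⟨i - 1, by omega⟩ ⟨j - 1, by omega⟩
  else 0

open Classical in
/-- Division of extended reals with the convention `c / 0 = ∞` for `c > 0`, `c / 0 = -∞` for
`c < 0` and `c / (±∞) = 0` for finite `c` (Mathlib's `EReal` division has `c / 0 = 0`).
The indeterminate `0 / 0` has the dummy value `0`. -/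
noncomputable def extDiv (c d : EReal) : EReal :=
  if d = 0 then (if 0 < c then ⊤ else if c < 0 then ⊥ else 0) else c / d

/-- The reciprocal `1 / d`, with the same convention. -/
noncomputable def extInv (d : EReal) : EReal := extDiv 1 d

/-! ### The ratios

`a i j` are the entries of the matrix, numbered from `1`; `n` is its size. -/

/-- `q_2 = -a_{11}⁻¹ a_{21}` and `q_{k+1} = -s_k⁻¹ a_{k+1,k}`,
where `s_k = a_{kk} + a_{k-1,k} q_k` (the values at `0` and `1` are dummies). -/
noncomputable def q (a : ℕ → ℕ → ℝ) : ℕ → EReal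
  | 0 => 0
  | 1 => 0
  | 2 => -extDiv (a 2 1) (a 1 1)
  | k + 3 => -extDiv (a (k + 3) (k + 2)) (a (k + 2) (k + 2) + a (k + 1) (k + 2) * q a (k + 2))

/-- `s_k = a_{kk} + a_{k-1,k} q_k`. -/
noncomputable def s (a : ℕ → ℕ → ℝ) (k : ℕ) : EReal := a k k + a (k - 1) k * q a k

/-- `r̂_2 = -a_{11}⁻¹ a_{12}` and `r̂_{k+1} = -s_k⁻¹ a_{k,k+1}`. -/
noncomputable def rHat (a : ℕ → ℕ → ℝ) (k : ℕ) : EReal :=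
  if k = 2 then -extDiv (a 1 2) (a 1 1) else -extDiv (a (k - 1) k) (s a (k - 1))

/-- `rDown n a m` is `r_{n-m}`: `r_{n-1} = -a_{nn}⁻¹ a_{n,n-1}` and, with `k = n - (m + 1)`,
`r_{k-1} = -t_k⁻¹ a_{k,k-1}`, where `t_k = a_{kk} + a_{k,k+1} r_k`. -/
noncomputable def rDown (n : ℕ) (a : ℕ → ℕ → ℝ) : ℕ → EReal
  | 0 => 0
  | 1 => -extDiv (a n (n - 1)) (a n n)
  | m + 2 => -extDiv (a (n - (m + 1)) (n - (m + 1) - 1))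
      (a (n - (m + 1)) (n - (m + 1)) + a (n - (m + 1)) (n - (m + 1) + 1) * rDown n a (m + 1))

/-- The ratio `r_k`, for `1 ≤ k ≤ n - 1`. -/
noncomputable def r (n : ℕ) (a : ℕ → ℕ → ℝ) (k : ℕ) : EReal := rDown n a (n - k)

/-- `t_k = a_{kk} + a_{k,k+1} r_k`. -/
noncomputable def t (n : ℕ) (a : ℕ → ℕ → ℝ) (k : ℕ) : EReal := a k k + a k (k + 1) * r n a k

/-- `q̂_{n-1} = -a_{nn}⁻¹ a_{n-1,n}` and `q̂_{k-1} = -t_k⁻¹ a_{k-1,k}`. -/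
noncomputable def qHat (n : ℕ) (a : ℕ → ℕ → ℝ) (k : ℕ) : EReal :=
  if k + 1 = n then -extDiv (a (n - 1) n) (a n n) else -extDiv (a k (k + 1)) (t n a (k + 1))

/-! ### A machine with an operation count

Programs are built from elementary arithmetic operations on registers that hold extended reals,
and from branchings on the tests "is zero" and "is infinite".  Each arithmetic operation and each
test costs one. -/

/-- Registers: the input `a i j`, the output `x i j`, the four families of ratios, and two
auxiliary registers. -/
inductive Reg
  | a (i j : ℕ)
  | x (i j : ℕ)
  | q (k : ℕ)
  | rHat (k : ℕ)
  | qHat (k : ℕ)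
  | r (k : ℕ)
  | p
  | c
  deriving DecidableEq

/-- Programs. -/
inductive Cmd
  | skip
  | neg (dst y : Reg)
  | inv (dst y : Reg)
  | add (dst y z : Reg)
  | mul (dst y z : Reg)
  | div (dst y z : Reg)
  | seq (P Q : Cmd)
  | ifZero (y : Reg) (P Q : Cmd)
  | ifInf (y : Reg) (P Q : Cmd)

/-- The contents of all registers. -/
abbrev Mem := Reg → EReal

open Classical in
/-- The memory after running a program. -/
noncomputable def Cmd.run : Cmd → Mem → Mem
  | .skip, m => m
  | .neg dst y, m => Function.update m dst (-m y)
  | .inv dst y, m => Function.update m dst (extInv (m y))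
  | .add dst y z, m => Function.update m dst (m y + m z)
  | .mul dst y z, m => Function.update m dst (m y * m z)
  | .div dst y z, m => Function.update m dst (extDiv (m y) (m z))
  | .seq P Q, m => Q.run (P.run m)
  | .ifZero y P Q, m => if m y = 0 then P.run m else Q.run m
  | .ifInf y P Q, m => if (m y).abs = ⊤ then P.run m else Q.run m

open Classical in
/-- The number of arithmetic operations and tests executed when running a program. -/
noncomputable def Cmd.cost : Cmd → Mem → ℕ
  | .skip, _ => 0
  | .neg _ _, _ => 1
  | .inv _ _, _ => 1
  | .add _ _ _, _ => 1
  | .mul _ _ _, _ => 1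
  | .div _ _ _, _ => 1
  | .seq P Q, m => P.cost m + Q.cost (P.run m)
  | .ifZero y P Q, m => 1 + if m y = 0 then P.cost m else Q.cost m
  | .ifInf y P Q, m => 1 + if (m y).abs = ⊤ then P.cost m else Q.cost m

/-- Run the programs of a list one after the other. -/
def Cmd.block : List Cmd → Cmd
  | [] => .skip
  | P :: L => .seq P (Cmd.block L)

/-- `for k = lo, lo + 1, …, hi do P k`. -/
def Cmd.forUp (lo hi : ℕ) (P : ℕ → Cmd) : Cmd :=
  Cmd.block ((List.range' lo (hi + 1 - lo)).map P)

/-- `for k = hi, hi - 1, …, lo do P k`. -/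
def Cmd.forDown (hi lo : ℕ) (P : ℕ → Cmd) : Cmd :=
  Cmd.block ((List.range' lo (hi + 1 - lo)).reverse.map P)

/-- The initial memory: the entries of the matrix in the registers `a i j`, and `0` elsewhere. -/
noncomputable def load (a : ℕ → ℕ → ℝ) : Mem
  | .a i j => (a i j : EReal)
  | _ => 0

/-! ### The inversion algorithm -/

/-- Step `k` (`1 ≤ k < n`) of the upward recurrence: compute `s_k` (which is `a_{11}` for `k = 1`,
since the registers `a 0 1` and `q 1` hold `0`), then `q_{k+1}` and `r̂_{k+1}`. -/
def ratiosUp (k : ℕ) : Cmd := .block [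
  .mul .p (.a (k - 1) k) (.q k),
  .add .p (.a k k) .p,
  .div (.q (k + 1)) (.a (k + 1) k) .p,
  .neg (.q (k + 1)) (.q (k + 1)),
  .div (.rHat (k + 1)) (.a k (k + 1)) .p,
  .neg (.rHat (k + 1)) (.rHat (k + 1))]

/-- Step `k` (`n ≥ k > 1`) of the downward recurrence: compute `t_k` (which is `a_{nn}` for
`k = n`, since the registers `a n (n + 1)` and `r n` hold `0`), then `q̂_{k-1}` and `r_{k-1}`. -/
def ratiosDown (k : ℕ) : Cmd := .block [
  .mul .p (.a k (k + 1)) (.r k),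
  .add .p (.a k k) .p,
  .div (.qHat (k - 1)) (.a (k - 1) k) .p,
  .neg (.qHat (k - 1)) (.qHat (k - 1)),
  .div (.r (k - 1)) (.a k (k - 1)) .p,
  .neg (.r (k - 1)) (.r (k - 1))]

/-- `dst := -(y / z) * w`. -/
def negQuotMul (dst y z w : Reg) : Cmd := .block [
  .div .c y z, .neg .c .c, .mul dst .c w]

/-- `x_{kk} := (a_{k-1,k} q_k + a_{kk})⁻¹`. -/
def startDiag (k : ℕ) : Cmd := .block [
  .mul .p (.a (k - 1) k) (.q k), .add .p .p (.a k k), .inv (.x k k) .p]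

/-- The element `x_{k,k-1}` when `q_k` is infinite and `k < n`. -/
def lowerMissing (k : ℕ) : Cmd :=
  .ifZero (.r k)
    (.ifZero (.a (k + 1) k)
      (.ifZero (.qHat k)
        (.ifZero (.a k (k + 1))
          (.inv (.x k (k - 1)) (.a (k - 1) k))
          (.block [
            .div .c (.a (k + 1) (k + 2)) (.a (k - 1) k),
            .mul (.x k (k - 1)) .c (.x (k + 2) (k + 1))]))
        (.block [
          .div .c (.a k (k + 1)) (.a (k - 1) k),
          .neg .c .c,
          .inv .p (.qHat k),
          .mul .c .c .p,
          .mul (.x k (k - 1)) .c (.x (k + 1) (k + 1))]))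
      (negQuotMul (.x k (k - 1)) (.a (k + 1) (k + 2)) (.a (k + 1) k) (.x (k + 2) (k - 1))))
    (.block [.inv .c (.r k), .mul (.x k (k - 1)) .c (.x (k + 1) (k - 1))])

/-- The elements `x_{s,k-1}`, `k ≤ s ≤ n`. -/
def lowerColumn (n k : ℕ) : Cmd :=
  .ifInf (.q k)
    (if k = n then .inv (.x n (n - 1)) (.a (n - 1) n)
     else .block [
      .div .c (.a (k + 1) k) (.a (k - 1) k),
      .neg .c .c,
      .forUp (k + 1) n (fun s => .mul (.x s (k - 1)) .c (.x s (k + 1))),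
      lowerMissing k])
    (.forUp k n (fun s => .mul (.x s (k - 1)) (.q k) (.x s k)))

/-- The element `x_{k-1,k-1}`. -/
def diagonal (k : ℕ) : Cmd :=
  .ifZero (.r (k - 1))
    (.ifZero (.qHat (k - 1))
      (.ifZero (.a k (k - 1))
        (.ifZero (.a (k - 1) k)
          (startDiag (k - 1))
          (.block [
            .div .c (.a k (k + 1)) (.a (k - 1) k),
            .neg .c .c,
            .mul .c .c (.rHat k),
            .mul (.x (k - 1) (k - 1)) .c (.x (k + 1) k)]))
        (negQuotMul (.x (k - 1) (k - 1)) (.a k (k + 1)) (.a k (k - 1)) (.x (k + 1) (k - 1))))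
      (.block [
        .inv .c (.qHat (k - 1)),
        .mul .c (.rHat k) .c,
        .mul (.x (k - 1) (k - 1)) .c (.x k k)]))
    (.block [.inv .c (.r (k - 1)), .mul (.x (k - 1) (k - 1)) .c (.x k (k - 1))])

/-- The element `x_{k,k+1}` when `q̂_k` is infinite and `k > 1`. -/
def upperMissing (k : ℕ) : Cmd :=
  .ifZero (.rHat k)
    (.ifZero (.a (k - 1) k)
      (.ifZero (.q k)
        (.ifZero (.a k (k - 1))
          (.block [
            .div .c (.a k (k + 1)) (.a (k + 1) k),
            .mul (.x k (k + 1)) .c (.x (k + 1) k)])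
          (.block [
            .div .c (.a (k - 1) (k - 2)) (.a (k + 1) k),
            .mul (.x k (k + 1)) .c (.x (k - 2) (k - 1))]))
        (.block [
          .div .c (.a k (k - 1)) (.a (k + 1) k),
          .neg .c .c,
          .inv .p (.q k),
          .mul .c .c .p,
          .mul (.x k (k + 1)) .c (.x (k - 1) (k - 1))]))
      (negQuotMul (.x k (k + 1)) (.a (k - 1) (k - 2)) (.a (k - 1) k) (.x (k - 2) (k + 1))))
    (.block [.inv .c (.rHat k), .mul (.x k (k + 1)) .c (.x (k - 1) (k + 1))])

/-- The elements `x_{s,k+1}`, `1 ≤ s ≤ k`. -/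
def upperColumn (k : ℕ) : Cmd :=
  .ifInf (.qHat k)
    (if k = 1 then .block [.div .c (.a 1 2) (.a 2 1), .mul (.x 1 2) .c (.x 2 1)]
     else .block [
      .div .c (.a (k - 1) k) (.a (k + 1) k),
      .neg .c .c,
      .forUp 1 (k - 1) (fun s => .mul (.x s (k + 1)) .c (.x s (k - 1))),
      upperMissing k])
    (.forUp 1 k (fun s => .mul (.x s (k + 1)) (.qHat k) (.x s k)))

/-- The whole algorithm for matrices of size `n`: the ratios, the starting element `x_{nn}`, the
lower triangle with the diagonal column by column from right to left, and then the upper triangle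
column by column from left to right. -/
def ratioInversion (n : ℕ) : Cmd := .block [
  .forUp 1 (n - 1) ratiosUp,
  .forDown n 2 ratiosDown,
  startDiag n,
  .forDown n 2 (fun k => .seq (lowerColumn n k) (diagonal k)),
  .forUp 1 (n - 1) upperColumn]

end TridiagInv

/-!
The inverse of a non-singular tridiagonal matrix has the closed form
`x i j = (∏ -a (m + 1) m) * lead j * trail i / det A` for `j ≤ i`, the product running over
`j ≤ m < i`, and the mirrored form above the diagonal (`entry_inv`). Here `lead j` is the leading
principal minor of order `j - 1` and `trail i` the trailing one on the rows after `i`; both satisfy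
three-term recurrences.

The ratios of the algorithm are quotients of consecutive minors, up to an entry of `A`:
`q k = -a k (k - 1) * lead (k - 1) / lead k`, and similarly for the other three families. This also
makes sense when the denominator vanishes (`IsRatio`): cutting `A` between rows `k` and `k + 1` gives
`det A = lead (k + 1) * trail k - a k (k + 1) * a (k + 1) k * lead k * trail (k + 1)`
(`lead_mul_trail`), so where `lead (k + 1)` or `trail k` is zero, both off-diagonal entries at the cut
and the two neighbouring minors are non-zero. Hence no indeterminate expression occurs, a ratio
is infinite exactly when its denominator is zero, and every formula of the theorem
becomes an identity between minors in which the vanishing minor has been replaced by means of its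
recurrence or of the determinant.

For the algorithm, `Known` records which entries of the inverse are in their registers. Each column
step extends this set using the formulas, and its cost is the length of the column plus a constant;
the two triangles together contain `n * (n - 1)` entries.
-/

namespace TridiagInv

open Finset

/-! ### Ratios of real numbers as extended reals -/

/-- The extended real `e` represents the point `u : v` of the projective line: it is `u / v` if
`v ≠ 0`, and infinite, of either sign, if `v = 0 ≠ u`. -/
def IsRatio (e : EReal) (u v : ℝ) : Prop :=
  (v ≠ 0 ∧ e = ((u / v : ℝ) : EReal)) ∨ (v = 0 ∧ u ≠ 0 ∧ e.abs = ⊤)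

theorem abs_coe_ne_top (x : ℝ) : (x : EReal).abs ≠ ⊤ := by
  rw [EReal.abs_def]; exact ENNReal.ofReal_ne_top

theorem abs_eq_top_iff {e : EReal} : e.abs = ⊤ ↔ e = ⊤ ∨ e = ⊥ := by
  induction e with
  | bot => simp
  | top => simp
  | coe x => simpa using abs_coe_ne_top x

theorem extDiv_coe_of_ne_zero (c : ℝ) {d : ℝ} (hd : d ≠ 0) :
    extDiv c d = ((c / d : ℝ) : EReal) := by
  rw [extDiv, if_neg (by exact_mod_cast hd), EReal.coe_div]

theorem extDiv_of_abs_eq_top (c : ℝ) {d : EReal} (hd : d.abs = ⊤) : extDiv c d = 0 := by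
  rcases abs_eq_top_iff.1 hd with rfl | rfl <;> simp [extDiv]

theorem abs_neg_extDiv_zero {c : ℝ} (hc : c ≠ 0) : (-extDiv c 0).abs = ⊤ := by
  rcases lt_or_gt_of_ne hc with h | h
  · simp [extDiv, h, h.not_gt]
  · simp [extDiv, h]

namespace IsRatio

variable {e : EReal} {u v : ℝ}

theorem eq_coe (h : IsRatio e u v) (hv : v ≠ 0) : e = ((u / v : ℝ) : EReal) := by
  rcases h with h | h
  · exact h.2
  · exact absurd h.1 hv

theorem abs_eq_top (h : IsRatio e u v) : e.abs = ⊤ ↔ v = 0 := by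
  rcases h with ⟨hv, rfl⟩ | ⟨hv, _, h⟩
  · simp only [hv, iff_false]; exact abs_coe_ne_top _
  · simp [hv, h]

theorem abs_lt_top (h : IsRatio e u v) : e.abs < ⊤ ↔ v ≠ 0 := by
  rw [lt_top_iff_ne_top, Ne, h.abs_eq_top]

theorem eq_zero (h : IsRatio e u v) : e = 0 ↔ u = 0 := by
  rcases h with ⟨hv, rfl⟩ | ⟨hv, hu, h⟩
  · rw [EReal.coe_eq_zero, div_eq_zero_iff]; simp [hv]
  · simp only [hu, iff_false]; rintro rfl; simp at h

theorem extInv_eq (h : IsRatio e u v) (hu : u ≠ 0) : extInv e = ((v / u : ℝ) : EReal) := by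
  rcases h with ⟨hv, rfl⟩ | ⟨hv, hu, h⟩
  · rw [extInv, show (1 : EReal) = ((1 : ℝ) : EReal) from rfl,
      extDiv_coe_of_ne_zero _ (div_ne_zero hu hv), one_div_div]
  · rw [extInv, show (1 : EReal) = ((1 : ℝ) : EReal) from rfl, extDiv_of_abs_eq_top _ h, hv]
    simp

/-- Division of a real number by a ratio; the hypothesis excludes `0 / 0`. -/
theorem neg_extDiv (h : IsRatio e u v) {c : ℝ} (hc : u = 0 → c ≠ 0) :
    IsRatio (-extDiv c e) (-c * v) u := by
  by_cases hu : u = 0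
  · have hv : v ≠ 0 := by
      rcases h with h | h
      · exact h.1
      · exact absurd hu h.2.1
    refine Or.inr ⟨hu, mul_ne_zero (neg_ne_zero.2 (hc hu)) hv, ?_⟩
    rw [h.eq_zero.2 hu]
    exact abs_neg_extDiv_zero (hc hu)
  · refine Or.inl ⟨hu, ?_⟩
    rcases h with ⟨hv, rfl⟩ | ⟨hv, _, h⟩
    · rw [extDiv_coe_of_ne_zero _ (div_ne_zero hu hv), ← EReal.coe_neg]
      congr 1
      field_simp
    · rw [extDiv_of_abs_eq_top _ h, hv]
      simp

/-- An affine function of a ratio; the hypothesis excludes `0 * ∞`. -/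
theorem add_mul (h : IsRatio e u v) {b c : ℝ} (hb : v = 0 → b ≠ 0) :
    IsRatio (c + b * e) (c * v + b * u) v := by
  rcases h with ⟨hv, rfl⟩ | ⟨hv, hu, h⟩
  · refine Or.inl ⟨hv, ?_⟩
    rw [← EReal.coe_mul, ← EReal.coe_add]
    congr 1
    field_simp
  · refine Or.inr ⟨hv, by simpa [hv] using ⟨hb hv, hu⟩, abs_eq_top_iff.2 ?_⟩
    rcases lt_or_gt_of_ne (hb hv) with hb | hb <;> rcases abs_eq_top_iff.1 h with rfl | rfl
    · rw [EReal.coe_mul_top_of_neg hb]; simp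
    · rw [EReal.coe_mul_bot_of_neg hb]; simp
    · rw [EReal.coe_mul_top_of_pos hb]; simp
    · rw [EReal.coe_mul_bot_of_pos hb]; simp

end IsRatio

/-! ### Principal minors and the entries of the inverse -/

/-- The array `a` of real numbers is supported on the entries `|i - j| ≤ 1`, `1 ≤ i, j ≤ n`. -/
structure IsBand (n : ℕ) (a : ℕ → ℕ → ℝ) : Prop where
  band : ∀ i j, i + 1 < j ∨ j + 1 < i → a i j = 0
  outside : ∀ i j, i = 0 ∨ j = 0 ∨ n < i ∨ n < j → a i j = 0

theorem isBand_entry {n : ℕ} {A : Matrix (Fin n) (Fin n) ℝ} (hA : IsTridiagonal A) :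
    IsBand n (entry A) where
  band i j h := by
    unfold entry
    split_ifs with h'
    · apply hA
      rw [lt_abs]
      simp only
      omega
    · rfl
  outside i j h := by
    unfold entry
    rw [dif_neg (by omega)]

/-- `lead a j` is the leading principal minor of order `j - 1`, given by its three-term
recurrence; the value `0` at `j = 0` makes the recurrence valid from the start. -/
def lead (a : ℕ → ℕ → ℝ) : ℕ → ℝ
  | 0 => 0
  | 1 => 1
  | j + 2 => a (j + 1) (j + 1) * lead a (j + 1) - a j (j + 1) * a (j + 1) j * lead a j

/-- `trail n a i` is the trailing principal minor on the rows and columns `i + 1, …, n`. -/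
noncomputable def trail (n : ℕ) (a : ℕ → ℕ → ℝ) (i : ℕ) : ℝ :=
  (Matrix.of fun u v : Fin (n - i) => a (i + 1 + u) (i + 1 + v)).det

theorem det_band_succ_succ {n : ℕ} {a : ℕ → ℕ → ℝ} (ha : IsBand n a) (k m : ℕ) :
    (Matrix.of fun u v : Fin (m + 2) => a (k + u) (k + v)).det =
      a k k * (Matrix.of fun u v : Fin (m + 1) => a (k + 1 + u) (k + 1 + v)).det -
        a k (k + 1) * a (k + 1) k *
          (Matrix.of fun u v : Fin m => a (k + 2 + u) (k + 2 + v)).det := by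
  rw [Matrix.det_succ_row_zero, Fin.sum_univ_succ, Fin.sum_univ_succ]
  have h0 : ∀ i : Fin m, a k (k + (i + 1 + 1)) = 0 := fun i => ha.band _ _ (by omega)
  have h1 : ∀ i : Fin m, a (k + (i + 1 + 1)) k = 0 := fun i => ha.band _ _ (by omega)
  simp only [Fin.val_zero, pow_zero, one_mul, Matrix.of_apply, add_zero, Fin.val_succ, h0,
    mul_zero, zero_mul, Finset.sum_const_zero, zero_add, pow_one]
  have e1 : ((Matrix.of fun u v : Fin (m + 2) => a (k + u) (k + v)).submatrix Fin.succ
      (Fin.succAbove 0)) = Matrix.of fun u v : Fin (m + 1) => a (k + 1 + u) (k + 1 + v) := by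
    ext u v
    simp only [Fin.succAbove_zero, Matrix.submatrix_apply, Matrix.of_apply, Fin.val_succ]
    congr 1 <;> ring
  have e2 : ((Matrix.of fun u v : Fin (m + 2) => a (k + u) (k + v)).submatrix Fin.succ
      (Fin.succAbove (Fin.succ 0))).det = a (k + 1) k *
        (Matrix.of fun u v : Fin m => a (k + 2 + u) (k + 2 + v)).det := by
    rw [Matrix.det_succ_column_zero, Fin.sum_univ_succ]
    have hz : (Fin.succAbove (Fin.succ (0 : Fin (m + 1))) (0 : Fin (m + 1))) = 0 := by
      simp
    simp only [Matrix.submatrix_apply, Matrix.of_apply, hz, Fin.val_succ, Fin.val_zero, h1,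
      add_zero, mul_zero, zero_mul, Finset.sum_const_zero, pow_zero, one_mul, zero_add]
    congr 2
    ext u v
    simp only [Matrix.submatrix_apply, Matrix.of_apply, Fin.succAbove_zero, Fin.val_succ,
      Fin.succ_succAbove_succ]
    congr 1 <;> ring
  rw [e1, e2]
  ring

section Band

variable {n : ℕ} {a : ℕ → ℕ → ℝ}

theorem trail_self : trail n a n = 1 := by
  unfold trail
  have : IsEmpty (Fin (n - n)) := by rw [Nat.sub_self]; infer_instance
  exact Matrix.det_isEmpty

theorem trail_rec (ha : IsBand n a) {k : ℕ} (hk : k < n) :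
    trail n a k = a (k + 1) (k + 1) * trail n a (k + 1) -
      a (k + 1) (k + 2) * a (k + 2) (k + 1) * trail n a (k + 2) := by
  obtain ⟨m, rfl⟩ : ∃ m, n = k + 1 + m := ⟨n - (k + 1), by omega⟩
  unfold trail
  rcases m with _ | m
  · rw [ha.outside (k + 1) (k + 2) (by omega)]
    have e1 : k + 1 + 0 - k = 1 := by omega
    have e2 : k + 1 + 0 - (k + 1) = 0 := by omega
    rw [e1, e2]
    simp
  · have e1 : k + 1 + (m + 1) - k = m + 2 := by omega
    have e2 : k + 1 + (m + 1) - (k + 1) = m + 1 := by omega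
    have e3 : k + 1 + (m + 1) - (k + 2) = m := by omega
    rw [e1, e2, e3]
    exact det_band_succ_succ ha (k + 1) m

/-- Expansion of the determinant `trail n a 0` along the cut between rows `k` and `k + 1`. -/
theorem lead_mul_trail (ha : IsBand n a) {k : ℕ} (hk : k ≤ n) :
    lead a (k + 1) * trail n a k -
      a k (k + 1) * a (k + 1) k * lead a k * trail n a (k + 1) = trail n a 0 := by
  induction k with
  | zero => simp [lead]
  | succ k ih =>
    rw [← ih (by omega), trail_rec ha (show k < n by omega), lead]
    ring

/-- Where a leading minor vanishes, the determinant reduces to the second term of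
`lead_mul_trail`, all of whose factors are therefore non-zero. -/
theorem of_lead_eq_zero (ha : IsBand n a) (h0 : trail n a 0 ≠ 0) {k : ℕ} (hk : k ≤ n)
    (h : lead a (k + 1) = 0) :
    a k (k + 1) ≠ 0 ∧ a (k + 1) k ≠ 0 ∧ lead a k ≠ 0 ∧ trail n a (k + 1) ≠ 0 := by
  rw [← lead_mul_trail ha hk, h] at h0
  refine ⟨?_, ?_, ?_, ?_⟩ <;> (intro h'; simp [h'] at h0)

theorem of_trail_eq_zero (ha : IsBand n a) (h0 : trail n a 0 ≠ 0) {k : ℕ} (hk : k ≤ n)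
    (h : trail n a k = 0) :
    a k (k + 1) ≠ 0 ∧ a (k + 1) k ≠ 0 ∧ lead a k ≠ 0 ∧ trail n a (k + 1) ≠ 0 := by
  rw [← lead_mul_trail ha hk, h] at h0
  refine ⟨?_, ?_, ?_, ?_⟩ <;> (intro h'; simp [h'] at h0)

/-- The entries of the adjugate of a tridiagonal matrix, numbered from `1`; the products carry the
signs. -/
noncomputable def adj (n : ℕ) (a : ℕ → ℕ → ℝ) (i j : ℕ) : ℝ :=
  if j ≤ i then (∏ m ∈ Ico j i, -a (m + 1) m) * lead a j * trail n a i
  else (∏ m ∈ Ico i j, -a m (m + 1)) * lead a i * trail n a j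

theorem adj_of_le {i j : ℕ} (h : j ≤ i) :
    adj n a i j = (∏ m ∈ Ico j i, -a (m + 1) m) * lead a j * trail n a i := if_pos h

theorem adj_of_ge {i j : ℕ} (h : i ≤ j) :
    adj n a i j = (∏ m ∈ Ico i j, -a m (m + 1)) * lead a i * trail n a j := by
  rcases h.eq_or_lt with rfl | h
  · simp [adj]
  · exact if_neg (by omega)

/-- Row `i + 1` of the matrix times column `j` of the adjugate. -/
theorem row_mul_adj (ha : IsBand n a) {i j : ℕ} (hi : i < n) :
    a (i + 1) i * adj n a i j + a (i + 1) (i + 1) * adj n a (i + 1) j +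
      a (i + 1) (i + 2) * adj n a (i + 2) j = if i + 1 = j then trail n a 0 else 0 := by
  rcases lt_trichotomy (i + 1) j with h | h | h
  · rw [if_neg h.ne, adj_of_ge (by omega), adj_of_ge (by omega), adj_of_ge (by omega),
      prod_eq_prod_Ico_succ_bot (show i < j by omega),
      prod_eq_prod_Ico_succ_bot (show i + 1 < j by omega), lead]
    ring
  · subst h
    rw [if_pos rfl, adj_of_ge (by omega), adj_of_le le_rfl, adj_of_le (by omega),
      ← lead_mul_trail ha (show i ≤ n by omega), trail_rec ha hi]
    simp
    ring
  · rw [if_neg (by omega), adj_of_le (by omega), adj_of_le (by omega), adj_of_le (by omega),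
      prod_Ico_succ_top (show j ≤ i + 1 by omega), prod_Ico_succ_top (show j ≤ i by omega),
      trail_rec ha hi]
    ring

theorem entry_succ_succ (A : Matrix (Fin n) (Fin n) ℝ) (i j : Fin n) :
    entry A (i + 1) (j + 1) = A i j := by
  unfold entry
  rw [dif_pos (by omega)]
  rfl

theorem trail_entry_zero (A : Matrix (Fin n) (Fin n) ℝ) : trail n (entry A) 0 = A.det := by
  unfold trail
  congr 1
  ext u v
  rw [← entry_succ_succ A u v, Matrix.of_apply]
  congr 1 <;> ring

theorem mul_adj {A : Matrix (Fin n) (Fin n) ℝ} (hA : IsTridiagonal A) :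
    A * (Matrix.of fun i j : Fin n => adj n (entry A) (i + 1) (j + 1)) = A.det • 1 := by
  ext i j
  have ha := isBand_entry hA
  set a := entry A with ha'
  rw [Matrix.mul_apply]
  have e1 : ∀ l : Fin n, A i l * (Matrix.of fun i j : Fin n => adj n a (i + 1) (j + 1)) l j =
      (fun l : ℕ => a (i + 1) (l + 1) * adj n a (l + 1) (j + 1)) l := fun l => by
    rw [ha', ← entry_succ_succ A]; rfl
  rw [Finset.sum_congr rfl fun l _ => e1 l, Fin.sum_univ_eq_sum_range
    (fun l : ℕ => a (i + 1) (l + 1) * adj n a (l + 1) (j + 1))]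
  -- the range of `l` is extended by the columns `0` and `n + 1`, in which `a` vanishes
  have e2 : ∑ l ∈ range n, a (i + 1) (l + 1) * adj n a (l + 1) (j + 1) =
      ∑ l ∈ range (n + 2), a (i + 1) l * adj n a l (j + 1) := by
    rw [sum_range_succ, sum_range_succ', ha.outside _ 0 (by omega),
      ha.outside _ (n + 1) (by omega)]
    simp
  have e3 : ∑ l ∈ range (n + 2), a (i + 1) l * adj n a l (j + 1) =
      ∑ l ∈ ({(i : ℕ), (i : ℕ) + 1, (i : ℕ) + 2} : Finset ℕ),
        a (i + 1) l * adj n a l (j + 1) := by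
    symm
    apply sum_subset
    · intro l hl
      simp only [mem_insert, mem_singleton] at hl
      simp only [mem_range]
      omega
    · intro l _ hl
      simp only [mem_insert, mem_singleton] at hl
      rw [ha.band _ l (by omega), zero_mul]
  rw [e2, e3, sum_insert (by simp), sum_insert (by simp), sum_singleton, ← add_assoc,
    row_mul_adj ha i.2, ← trail_entry_zero, ← ha']
  simp [Matrix.one_apply, Fin.ext_iff]

theorem entry_inv {A : Matrix (Fin n) (Fin n) ℝ} (hA : IsTridiagonal A) (hdet : IsUnit A.det)
    {i j : ℕ} (hi : 1 ≤ i) (hin : i ≤ n) (hj : 1 ≤ j) (hjn : j ≤ n) :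
    entry A⁻¹ i j = adj n (entry A) i j / trail n (entry A) 0 := by
  obtain ⟨i, rfl⟩ := Nat.exists_eq_add_of_le' hi
  obtain ⟨j, rfl⟩ := Nat.exists_eq_add_of_le' hj
  have h : A⁻¹ = A.det⁻¹ • (Matrix.of fun i j : Fin n => adj n (entry A) (i + 1) (j + 1)) := by
    apply Matrix.inv_eq_right_inv
    rw [Matrix.mul_smul, mul_adj hA, smul_smul, inv_mul_cancel₀ hdet.ne_zero, one_smul]
  have e := entry_succ_succ A⁻¹ ⟨i, by omega⟩ ⟨j, by omega⟩
  simp only at e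
  rw [e, trail_entry_zero, h]
  simp
  ring

/-! ### The ratios in terms of the principal minors -/

theorem q_succ {k : ℕ} (hk : 1 ≤ k) : q a (k + 1) = -extDiv (a (k + 1) k) (s a k) := by
  obtain ⟨k, rfl⟩ := Nat.exists_eq_add_of_le' hk
  rcases k with _ | k
  · simp [q, s]
  · rfl

theorem rHat_succ {k : ℕ} (hk : 1 ≤ k) : rHat a (k + 1) = -extDiv (a k (k + 1)) (s a k) := by
  obtain ⟨k, rfl⟩ := Nat.exists_eq_add_of_le' hk
  rcases k with _ | k
  · simp [rHat, s, q]
  · simp [rHat]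

theorem r_self : r n a n = 0 := by simp [r, rDown]

theorem r_pred {k : ℕ} (hk : k < n) : r n a k = -extDiv (a (k + 1) k) (t n a (k + 1)) := by
  obtain ⟨m, rfl⟩ : ∃ m, n = k + 1 + m := ⟨n - (k + 1), by omega⟩
  have e1 : k + 1 + m - k = m + 1 := by omega
  have e2 : k + 1 + m - (k + 1) = m := by omega
  unfold t r
  rw [e1, e2]
  rcases m with _ | m
  · simp [rDown]
  · have e : k + 1 + (m + 1) - (m + 1) = k + 1 := by omega
    rw [rDown, e]
    simp

theorem qHat_pred {k : ℕ} (hk : k < n) :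
    qHat n a k = -extDiv (a k (k + 1)) (t n a (k + 1)) := by
  unfold qHat
  split_ifs with h
  · subst h
    simp [t, r_self]
  · rfl

/-- The ratios `q` together with the denominators `s`, which need each other in the induction. -/
theorem isRatio_q (ha : IsBand n a) (h0 : trail n a 0 ≠ 0) {k : ℕ} (hk : k < n) :
    IsRatio (q a (k + 1)) (-a (k + 1) k * lead a k) (lead a (k + 1)) ∧
      IsRatio (s a (k + 1)) (lead a (k + 2)) (lead a (k + 1)) := by
  have step : ∀ k, k < n →
      IsRatio (q a (k + 1)) (-a (k + 1) k * lead a k) (lead a (k + 1)) →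
      IsRatio (s a (k + 1)) (lead a (k + 2)) (lead a (k + 1)) := fun k hk h => by
    have := h.add_mul (b := a k (k + 1)) (c := a (k + 1) (k + 1))
      fun h => (of_lead_eq_zero ha h0 hk.le h).1
    rw [show lead a (k + 2) = a (k + 1) (k + 1) * lead a (k + 1) +
      a k (k + 1) * (-a (k + 1) k * lead a k) by rw [lead]; ring]
    exact this
  induction k with
  | zero =>
    have h : IsRatio (q a 1) (-a 1 0 * lead a 0) (lead a 1) := Or.inl (by simp [lead, q])
    exact ⟨h, step 0 hk h⟩
  | succ k ih =>
    have h : IsRatio (q a (k + 2)) (-a (k + 2) (k + 1) * lead a (k + 1)) (lead a (k + 2)) := by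
      rw [q_succ (by omega)]
      exact (ih (by omega)).2.neg_extDiv fun h => (of_lead_eq_zero ha h0 hk.le h).2.1
    exact ⟨h, step _ hk h⟩

theorem isRatio_rHat (ha : IsBand n a) (h0 : trail n a 0 ≠ 0) {k : ℕ} (hk1 : 1 ≤ k)
    (hk : k < n) : IsRatio (rHat a (k + 1)) (-a k (k + 1) * lead a k) (lead a (k + 1)) := by
  obtain ⟨k, rfl⟩ := Nat.exists_eq_add_of_le' hk1
  rw [rHat_succ (by omega)]
  exact (isRatio_q ha h0 (by omega)).2.neg_extDiv fun h => (of_lead_eq_zero ha h0 hk.le h).1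

theorem isRatio_r (ha : IsBand n a) (h0 : trail n a 0 ≠ 0) {k : ℕ} (hk : k ≤ n) :
    IsRatio (r n a k) (-a (k + 1) k * trail n a (k + 1)) (trail n a k) := by
  induction hk using Nat.decreasingInduction with
  | self =>
    rw [r_self, ha.outside (n + 1) n (by omega), trail_self]
    exact Or.inl (by simp)
  | of_succ k hk ih =>
    rw [r_pred hk]
    have h := ih.add_mul (b := a (k + 1) (k + 2)) (c := a (k + 1) (k + 1))
      fun h => (of_trail_eq_zero ha h0 hk h).1
    refine IsRatio.neg_extDiv ?_ fun h => (of_trail_eq_zero ha h0 hk.le h).2.1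
    rw [show trail n a k = a (k + 1) (k + 1) * trail n a (k + 1) +
      a (k + 1) (k + 2) * (-a (k + 2) (k + 1) * trail n a (k + 2)) by rw [trail_rec ha hk]; ring]
    exact h

theorem isRatio_t (ha : IsBand n a) (h0 : trail n a 0 ≠ 0) {k : ℕ} (hk : k < n) :
    IsRatio (t n a (k + 1)) (trail n a k) (trail n a (k + 1)) := by
  have h := (isRatio_r ha h0 hk).add_mul (b := a (k + 1) (k + 2)) (c := a (k + 1) (k + 1))
      fun h => (of_trail_eq_zero ha h0 hk h).1
  rw [show trail n a k = a (k + 1) (k + 1) * trail n a (k + 1) +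
    a (k + 1) (k + 2) * (-a (k + 2) (k + 1) * trail n a (k + 2)) by rw [trail_rec ha hk]; ring]
  exact h

theorem isRatio_qHat (ha : IsBand n a) (h0 : trail n a 0 ≠ 0) {k : ℕ} (hk : k < n) :
    IsRatio (qHat n a k) (-a k (k + 1) * trail n a (k + 1)) (trail n a k) := by
  rw [qHat_pred hk]
  exact (isRatio_t ha h0 hk).neg_extDiv fun h => (of_trail_eq_zero ha h0 hk.le h).1

end Band

/-! ### The formulas for the entries of the inverse -/

section Formulas

variable {n : ℕ} {a : ℕ → ℕ → ℝ}

theorem adj_self (i : ℕ) : adj n a i i = lead a i * trail n a i := by simp [adj]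

theorem adj_lower_one (i : ℕ) :
    adj n a (i + 1) i = -a (i + 1) i * lead a i * trail n a (i + 1) := by
  simp [adj]

theorem adj_lower_two (i : ℕ) :
    adj n a (i + 2) i = a (i + 1) i * a (i + 2) (i + 1) * lead a i * trail n a (i + 2) := by
  rw [adj_of_le (by omega), prod_Ico_succ_top (by omega), prod_Ico_succ_top (by omega)]
  simp

theorem adj_lower_three (i : ℕ) : adj n a (i + 3) i =
    -(a (i + 1) i * a (i + 2) (i + 1) * a (i + 3) (i + 2)) * lead a i * trail n a (i + 3) := by
  rw [adj_of_le (by omega), prod_Ico_succ_top (by omega), prod_Ico_succ_top (by omega),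
    prod_Ico_succ_top (by omega)]
  simp

theorem adj_upper_one (i : ℕ) :
    adj n a i (i + 1) = -a i (i + 1) * lead a i * trail n a (i + 1) := by
  simp [adj]

theorem adj_upper_two (i : ℕ) :
    adj n a i (i + 2) = a i (i + 1) * a (i + 1) (i + 2) * lead a i * trail n a (i + 2) := by
  rw [adj_of_ge (by omega), prod_Ico_succ_top (by omega), prod_Ico_succ_top (by omega)]
  simp

theorem adj_upper_three (i : ℕ) : adj n a i (i + 3) =
    -(a i (i + 1) * a (i + 1) (i + 2) * a (i + 2) (i + 3)) * lead a i * trail n a (i + 3) := by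
  rw [adj_of_ge (by omega), prod_Ico_succ_top (by omega), prod_Ico_succ_top (by omega),
    prod_Ico_succ_top (by omega)]
  simp

variable {x : ℕ → ℕ → ℝ}

/-- The array `x` holds the entries of the inverse of the tridiagonal matrix `a` of size `n`. -/
def IsInverse (n : ℕ) (a x : ℕ → ℕ → ℝ) : Prop :=
  ∀ i j, 1 ≤ i → i ≤ n → 1 ≤ j → j ≤ n → x i j = adj n a i j / trail n a 0

theorem lower_of_finite (ha : IsBand n a) (h0 : trail n a 0 ≠ 0) (hx : IsInverse n a x)
    {k : ℕ} (hk : 2 ≤ k) (hkn : k ≤ n) (hq : (q a k).abs < ⊤) {s : ℕ} (hs : k ≤ s)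
    (hsn : s ≤ n) : (x s (k - 1) : EReal) = q a k * (x s k : EReal) := by
  obtain ⟨k, rfl⟩ := Nat.exists_eq_add_of_le' hk
  have H := (isRatio_q ha h0 (show k + 1 < n by omega)).1
  have hl := H.abs_lt_top.1 hq
  rw [H.eq_coe hl, ← EReal.coe_mul, EReal.coe_eq_coe_iff, hx _ _ (by omega) hsn (by omega)
    (by omega), hx _ _ (by omega) hsn (by omega) hkn, adj_of_le (by omega), adj_of_le hs,
    show k + 2 - 1 = k + 1 by omega, prod_eq_prod_Ico_succ_bot (by omega)]
  field_simp

theorem upper_of_finite (ha : IsBand n a) (h0 : trail n a 0 ≠ 0) (hx : IsInverse n a x)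
    {k : ℕ} (hk : 1 ≤ k) (hkn : k + 1 ≤ n) (hq : (qHat n a k).abs < ⊤) {s : ℕ} (hs : 1 ≤ s)
    (hsk : s ≤ k) : (x s (k + 1) : EReal) = qHat n a k * (x s k : EReal) := by
  have H := isRatio_qHat ha h0 (show k < n by omega)
  have hl := H.abs_lt_top.1 hq
  rw [H.eq_coe hl, ← EReal.coe_mul, EReal.coe_eq_coe_iff, hx _ _ (by omega) (by omega) (by omega)
    (by omega), hx _ _ (by omega) (by omega) (by omega) (by omega), adj_of_ge (by omega),
    adj_of_ge hsk, prod_Ico_succ_top (by omega)]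
  field_simp

/-- If `q k` is infinite, the determinant is the single product
`-a (k - 1) k * a k (k - 1) * lead (k - 1) * trail k`, and `x k (k - 1)` collapses to
`(a (k - 1) k)⁻¹`. -/
theorem lower_of_infinite (ha : IsBand n a) (h0 : trail n a 0 ≠ 0) (hx : IsInverse n a x)
    {k : ℕ} (hk : 2 ≤ k) (hkn : k ≤ n) (hq : (q a k).abs = ⊤) :
    a (k - 1) k ≠ 0 ∧ x k (k - 1) = (a (k - 1) k)⁻¹ ∧
      ∀ s, k < s → s ≤ n → x s (k - 1) = -a (k + 1) k * (a (k - 1) k)⁻¹ * x s (k + 1) := by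
  obtain ⟨k, rfl⟩ := Nat.exists_eq_add_of_le' hk
  have hl := (isRatio_q ha h0 (show k + 1 < n by omega)).1.abs_eq_top.1 hq
  obtain ⟨h1, h2, h3, h4⟩ := of_lead_eq_zero ha h0 (show k + 1 ≤ n by omega) hl
  have hD := lead_mul_trail ha (show k + 1 ≤ n by omega)
  rw [show k + 1 + 1 = k + 2 by omega] at *
  rw [show k + 2 - 1 = k + 1 by omega]
  refine ⟨h1, ?_, fun s hs hsn => ?_⟩
  · rw [hx _ _ (by omega) (by omega) (by omega) (by omega), adj_lower_one, ← hD, hl]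
    field_simp
    ring
  · rw [hx _ _ (by omega) (by omega) (by omega) (by omega),
      hx _ _ (by omega) (by omega) (by omega) (by omega), adj_of_le (by omega),
      adj_of_le (by omega), prod_eq_prod_Ico_succ_bot (by omega),
      prod_eq_prod_Ico_succ_bot (by omega), show lead a (k + 2 + 1) =
        a (k + 2) (k + 2) * lead a (k + 2) - a (k + 1) (k + 2) * a (k + 2) (k + 1) *
          lead a (k + 1) from rfl, hl]
    field_simp
    ring

theorem upper_of_infinite (ha : IsBand n a) (h0 : trail n a 0 ≠ 0) (hx : IsInverse n a x)
    {k : ℕ} (hk : 1 ≤ k) (hkn : k + 1 ≤ n) (hq : (qHat n a k).abs = ⊤) :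
    a (k + 1) k ≠ 0 ∧ x k (k + 1) = (a (k + 1) k)⁻¹ ∧
      x k (k + 1) = a k (k + 1) * (a (k + 1) k)⁻¹ * x (k + 1) k ∧
      ∀ s, 1 ≤ s → s < k → x s (k + 1) = -a (k - 1) k * (a (k + 1) k)⁻¹ * x s (k - 1) := by
  have hl := (isRatio_qHat ha h0 (show k < n by omega)).abs_eq_top.1 hq
  obtain ⟨h1, h2, h3, h4⟩ := of_trail_eq_zero ha h0 (show k ≤ n by omega) hl
  have hD := lead_mul_trail ha (show k ≤ n by omega)
  refine ⟨h2, ?_, ?_, fun s hs hsk => ?_⟩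
  · rw [hx _ _ (by omega) (by omega) (by omega) (by omega), adj_upper_one, ← hD, hl]
    field_simp
    ring
  · rw [hx _ _ (by omega) (by omega) (by omega) (by omega),
      hx _ _ (by omega) (by omega) (by omega) (by omega), adj_upper_one, adj_lower_one]
    field_simp
  · obtain ⟨k, rfl⟩ := Nat.exists_eq_add_of_le' hk
    rw [hx _ _ (by omega) (by omega) (by omega) (by omega),
      hx _ _ (by omega) (by omega) (by omega) (by omega), adj_of_ge (by omega),
      adj_of_ge (by omega), prod_Ico_succ_top (by omega), prod_Ico_succ_top (by omega),
      show k + 1 - 1 = k by omega, trail_rec ha (show k < n by omega), hl]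
    field_simp
    ring

/-- The expressions for `x k (k - 1)` when `q k` is infinite. All of them equal
`(a (k - 1) k)⁻¹`, since `trail k` and `lead (k - 1)` are non-zero. -/
theorem lower_missing (ha : IsBand n a) (h0 : trail n a 0 ≠ 0) (hx : IsInverse n a x)
    {k : ℕ} (hk : 2 ≤ k) (hkn : k < n) (hq : (q a k).abs = ⊤) :
    (r n a k ≠ 0 →
      (x k (k - 1) : EReal) = extInv (r n a k) * (x (k + 1) (k - 1) : EReal)) ∧
    (r n a k = 0 → a (k + 1) k ≠ 0 → k + 2 ≤ n ∧
      x k (k - 1) = -a (k + 1) (k + 2) * (a (k + 1) k)⁻¹ * x (k + 2) (k - 1)) ∧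
    (r n a k = 0 → a (k + 1) k = 0 → qHat n a k ≠ 0 →
      (x k (k - 1) : EReal) = ((-a k (k + 1) * (a (k - 1) k)⁻¹ : ℝ) : EReal) *
        extInv (qHat n a k) * (x (k + 1) (k + 1) : EReal)) ∧
    (r n a k = 0 → a (k + 1) k = 0 → qHat n a k = 0 → a k (k + 1) ≠ 0 → k + 2 ≤ n ∧
      x k (k - 1) = a (k + 1) (k + 2) * (a (k - 1) k)⁻¹ * x (k + 2) (k + 1)) ∧
    (r n a k = 0 → a (k + 1) k = 0 → qHat n a k = 0 → a k (k + 1) = 0 →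
      x k (k - 1) = (a (k - 1) k)⁻¹) := by
  have hval := (lower_of_infinite ha h0 hx hk hkn.le hq).2.1
  obtain ⟨k, rfl⟩ := Nat.exists_eq_add_of_le' hk
  have hl := (isRatio_q ha h0 (show k + 1 < n by omega)).1.abs_eq_top.1 hq
  obtain ⟨h1, h2, h3, h4⟩ := of_lead_eq_zero ha h0 (show k + 1 ≤ n by omega) hl
  have hD := lead_mul_trail ha (show k + 1 ≤ n by omega)
  have hr := isRatio_r ha h0 (show k + 2 ≤ n by omega)
  have hqh := isRatio_qHat ha h0 (show k + 2 < n by omega)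
  -- a vanishing minor on `k + 4, …, n` is not the empty one
  have hlast : trail n a (k + 3) = 0 → k + 4 ≤ n := fun h => by
    by_contra h'
    rw [show k + 3 = n by omega, trail_self] at h
    exact one_ne_zero h
  have hrec := trail_rec ha (show k + 2 < n by omega)
  have hle : lead a (k + 3) = - a (k + 1) (k + 2) * a (k + 2) (k + 1) * lead a (k + 1) := by
    rw [lead, hl]; ring
  rw [hl] at hD
  rw [show k + 2 - 1 = k + 1 by omega] at *
  simp only [add_assoc, Nat.reduceAdd] at *
  refine ⟨fun hr0 => ?_, fun hr0 ha0 => ?_, fun hr0 ha0 hq0 => ?_, fun hr0 ha0 hq0 hb0 => ?_,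
    fun _ _ _ _ => hval⟩
  · have hu := mt hr.eq_zero.2 hr0
    have hu' := mul_ne_zero_iff.1 hu
    have hu1 := neg_ne_zero.1 hu'.1
    have hu2 := hu'.2
    rw [hr.extInv_eq hu, ← EReal.coe_mul, EReal.coe_eq_coe_iff, hval,
      hx _ _ (by omega) (by omega) (by omega) (by omega), adj_lower_two, ← hD]
    field_simp
    ring
  · have ht : trail n a (k + 3) = 0 := by simpa [ha0] using hr.eq_zero.1 hr0
    refine ⟨hlast ht, ?_⟩
    have hn := hlast ht
    rw [ht, mul_zero, zero_sub] at hrec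
    rw [hrec] at h4
    have h5 := right_ne_zero_of_mul (neg_ne_zero.1 h4)
    have h6 := mul_ne_zero_iff.1 (left_ne_zero_of_mul (neg_ne_zero.1 h4))
    have h7 := h6.1
    have h8 := h6.2
    rw [hval, hx _ _ (by omega) (by omega) (by omega) (by omega), adj_lower_three, ← hD, hrec]
    field_simp
    ring
  · have hu := mt hqh.eq_zero.2 hq0
    have hu' := mul_ne_zero_iff.1 hu
    have hu1 := neg_ne_zero.1 hu'.1
    have hu2 := hu'.2
    rw [hqh.extInv_eq hu, ← EReal.coe_mul, ← EReal.coe_mul, EReal.coe_eq_coe_iff, hval,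
      hx _ _ (by omega) (by omega) (by omega) (by omega), adj_self, ← hD, hle]
    field_simp
    ring
  · have ht : trail n a (k + 3) = 0 := by simpa [hb0] using hqh.eq_zero.1 hq0
    have hn := hlast ht
    refine ⟨hn, ?_⟩
    rw [ht, mul_zero, zero_sub] at hrec
    rw [hrec] at h4
    have h5 := right_ne_zero_of_mul (neg_ne_zero.1 h4)
    have h6 := mul_ne_zero_iff.1 (left_ne_zero_of_mul (neg_ne_zero.1 h4))
    have h7 := h6.1
    have h8 := h6.2
    rw [hval, hx _ _ (by omega) (by omega) (by omega) (by omega), adj_lower_one, ← hD, hrec, hle]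
    field_simp
    ring

/-- The expressions for `x k (k + 1)` when `qHat k` is infinite; all of them equal
`(a (k + 1) k)⁻¹`. -/
theorem upper_missing (ha : IsBand n a) (h0 : trail n a 0 ≠ 0) (hx : IsInverse n a x)
    {k : ℕ} (hk : 1 < k) (hkn : k + 1 ≤ n) (hq : (qHat n a k).abs = ⊤) :
    (rHat a k ≠ 0 →
      (x k (k + 1) : EReal) = extInv (rHat a k) * (x (k - 1) (k + 1) : EReal)) ∧
    (rHat a k = 0 → a (k - 1) k ≠ 0 → 3 ≤ k ∧
      x k (k + 1) = -a (k - 1) (k - 2) * (a (k - 1) k)⁻¹ * x (k - 2) (k + 1)) ∧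
    (rHat a k = 0 → a (k - 1) k = 0 → q a k ≠ 0 →
      (x k (k + 1) : EReal) = ((-a k (k - 1) * (a (k + 1) k)⁻¹ : ℝ) : EReal) *
        extInv (q a k) * (x (k - 1) (k - 1) : EReal)) ∧
    (rHat a k = 0 → a (k - 1) k = 0 → q a k = 0 → a k (k - 1) ≠ 0 → 3 ≤ k ∧
      x k (k + 1) = a (k - 1) (k - 2) * (a (k + 1) k)⁻¹ * x (k - 2) (k - 1)) ∧
    (rHat a k = 0 → a (k - 1) k = 0 → q a k = 0 → a k (k - 1) = 0 →
      x k (k + 1) = a k (k + 1) * (a (k + 1) k)⁻¹ * x (k + 1) k) := by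
  have hval := (upper_of_infinite ha h0 hx hk.le hkn hq).2.1
  have hval' := (upper_of_infinite ha h0 hx hk.le hkn hq).2.2.1
  obtain ⟨k, rfl⟩ := Nat.exists_eq_add_of_le' (show 2 ≤ k from hk)
  have hl := (isRatio_qHat ha h0 (show k + 2 < n by omega)).abs_eq_top.1 hq
  obtain ⟨h1, h2, h3, h4⟩ := of_trail_eq_zero ha h0 (show k + 2 ≤ n by omega) hl
  have hD := lead_mul_trail ha (show k + 2 ≤ n by omega)
  have hr := isRatio_rHat ha h0 (show 1 ≤ k + 1 by omega) (show k + 1 < n by omega)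
  have hqh := (isRatio_q ha h0 (show k + 1 < n by omega)).1
  -- a vanishing leading minor is not the empty one
  have hfirst : lead a (k + 1) = 0 → 1 ≤ k := fun h => by
    by_contra h'
    rw [show k = 0 by omega] at h
    exact one_ne_zero h
  have hrec : lead a (k + 2) = a (k + 1) (k + 1) * lead a (k + 1) -
    a k (k + 1) * a (k + 1) k * lead a k := rfl
  have htr : trail n a (k + 1) = - a (k + 2) (k + 3) * a (k + 3) (k + 2) * trail n a (k + 3) := by
    rw [trail_rec ha (by omega), hl]; ring
  rw [hl] at hD
  rw [show k + 2 - 1 = k + 1 by omega, show k + 2 - 2 = k by omega] at *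
  simp only [add_assoc, Nat.reduceAdd] at *
  refine ⟨fun hr0 => ?_, fun hr0 ha0 => ?_, fun hr0 ha0 hq0 => ?_, fun hr0 ha0 hq0 hb0 => ?_,
    fun _ _ _ _ => hval'⟩
  · have hu := mt hr.eq_zero.2 hr0
    have hu' := mul_ne_zero_iff.1 hu
    have hu1 := neg_ne_zero.1 hu'.1
    have hu2 := hu'.2
    rw [hr.extInv_eq hu, ← EReal.coe_mul, EReal.coe_eq_coe_iff, hval,
      hx _ _ (by omega) (by omega) (by omega) (by omega), adj_upper_two, ← hD]
    field_simp
    ring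
  · have ht : lead a (k + 1) = 0 := by simpa [ha0] using hr.eq_zero.1 hr0
    have hn := hfirst ht
    refine ⟨by omega, ?_⟩
    rw [ht, mul_zero, zero_sub] at hrec
    rw [hrec] at h3
    have h5 := right_ne_zero_of_mul (neg_ne_zero.1 h3)
    have h6 := mul_ne_zero_iff.1 (left_ne_zero_of_mul (neg_ne_zero.1 h3))
    have h7 := h6.1
    have h8 := h6.2
    rw [hval, hx _ _ (by omega) (by omega) (by omega) (by omega), adj_upper_three, ← hD, hrec]
    field_simp
    ring
  · have hu := mt hqh.eq_zero.2 hq0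
    have hu' := mul_ne_zero_iff.1 hu
    have hu1 := neg_ne_zero.1 hu'.1
    have hu2 := hu'.2
    rw [hqh.extInv_eq hu, ← EReal.coe_mul, ← EReal.coe_mul, EReal.coe_eq_coe_iff, hval,
      hx _ _ (by omega) (by omega) (by omega) (by omega), adj_self, ← hD, htr]
    field_simp
    ring
  · have ht : lead a (k + 1) = 0 := by simpa [hb0] using hqh.eq_zero.1 hq0
    have hn := hfirst ht
    refine ⟨by omega, ?_⟩
    rw [ht, mul_zero, zero_sub] at hrec
    rw [hrec] at h3
    have h5 := right_ne_zero_of_mul (neg_ne_zero.1 h3)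
    have h6 := mul_ne_zero_iff.1 (left_ne_zero_of_mul (neg_ne_zero.1 h3))
    have h7 := h6.1
    have h8 := h6.2
    rw [hval, hx _ _ (by omega) (by omega) (by omega) (by omega), adj_upper_one, ← hD, hrec, htr]
    field_simp
    ring

/-- If the matrix is block triangular with a cut after row `k`, then `x k k` is the last diagonal
entry of the inverse of the leading block, which is `(s k)⁻¹`. This includes the starting element
`x n n`. -/
theorem start_diag (ha : IsBand n a) (h0 : trail n a 0 ≠ 0) (hx : IsInverse n a x)
    {k : ℕ} (hk : 1 ≤ k) (hkn : k ≤ n) (hz : a k (k + 1) * a (k + 1) k = 0) :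
    (x k k : EReal) = extInv (a (k - 1) k * q a k + a k k) := by
  obtain ⟨k, rfl⟩ := Nat.exists_eq_add_of_le' hk
  have hs := (isRatio_q ha h0 (show k < n by omega)).2
  have hD := lead_mul_trail ha hkn
  rw [hz, zero_mul, zero_mul, sub_zero] at hD
  rw [← hD] at h0
  have h1 := left_ne_zero_of_mul h0
  have h2 := right_ne_zero_of_mul h0
  rw [add_comm (_ * q a (k + 1))]
  change _ = extInv (s a (k + 1))
  rw [hs.extInv_eq h1, EReal.coe_eq_coe_iff, hx _ _ (by omega) (by omega) (by omega) (by omega),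
    ← hD, adj_self]
  field_simp

theorem diagonal_formula (ha : IsBand n a) (h0 : trail n a 0 ≠ 0) (hx : IsInverse n a x)
    {k : ℕ} (hk : 2 ≤ k) (hkn : k ≤ n) :
    (r n a (k - 1) ≠ 0 →
      (x (k - 1) (k - 1) : EReal) = extInv (r n a (k - 1)) * (x k (k - 1) : EReal)) ∧
    (r n a (k - 1) = 0 → qHat n a (k - 1) ≠ 0 → (rHat a k).abs < ⊤ ∧
      (x (k - 1) (k - 1) : EReal) =
        rHat a k * extInv (qHat n a (k - 1)) * (x k k : EReal)) ∧
    (r n a (k - 1) = 0 → qHat n a (k - 1) = 0 → a k (k - 1) ≠ 0 → k + 1 ≤ n ∧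
      x (k - 1) (k - 1) = -a k (k + 1) * (a k (k - 1))⁻¹ * x (k + 1) (k - 1)) ∧
    (r n a (k - 1) = 0 → qHat n a (k - 1) = 0 → a k (k - 1) = 0 → a (k - 1) k ≠ 0 →
      k + 1 ≤ n ∧ (rHat a k).abs < ⊤ ∧
      (x (k - 1) (k - 1) : EReal) = ((-a k (k + 1) * (a (k - 1) k)⁻¹ : ℝ) : EReal) *
        rHat a k * (x (k + 1) k : EReal)) ∧
    (r n a (k - 1) = 0 → qHat n a (k - 1) = 0 → a k (k - 1) = 0 → a (k - 1) k = 0 →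
      (x (k - 1) (k - 1) : EReal) = extInv
        ((a (k - 2) (k - 1) : EReal) * q a (k - 1) + (a (k - 1) (k - 1) : EReal))) := by
  obtain ⟨k, rfl⟩ := Nat.exists_eq_add_of_le' hk
  have hD := lead_mul_trail ha (show k + 1 ≤ n by omega)
  have hr := isRatio_r ha h0 (show k + 1 ≤ n by omega)
  have hqh := isRatio_qHat ha h0 (show k + 1 < n by omega)
  have hrh := isRatio_rHat ha h0 (show 1 ≤ k + 1 by omega) (show k + 1 < n by omega)
  -- a vanishing minor on `k + 3, …, n` is not the empty one
  have hlast : trail n a (k + 2) = 0 → k + 3 ≤ n := fun h => by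
    by_contra h'
    rw [show k + 2 = n by omega, trail_self] at h
    exact one_ne_zero h
  have hrec := trail_rec ha (show k + 1 < n by omega)
  have hfin : r n a (k + 1) = 0 → trail n a (k + 1) ≠ 0 := fun h h' => by
    have := hr.abs_eq_top.2 h'
    rw [h] at this
    simp at this
  -- if `a (k + 2) (k + 1) = 0`, the determinant splits into two minors
  have hsplit : a (k + 2) (k + 1) = 0 →
      lead a (k + 2) * trail n a (k + 1) = trail n a 0 ∧ lead a (k + 2) ≠ 0 := fun h => by
    have h : lead a (k + 2) * trail n a (k + 1) = trail n a 0 := by simpa [h] using hD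
    exact ⟨h, fun h' => h0 (by rw [← h, h', zero_mul])⟩
  rw [show k + 2 - 1 = k + 1 by omega, show k + 2 - 2 = k by omega] at *
  simp only [add_assoc, Nat.reduceAdd] at *
  refine ⟨fun hr0 => ?_, fun hr0 hq0 => ?_, fun hr0 hq0 ha0 => ?_, fun hr0 hq0 ha0 hb0 => ?_,
    fun hr0 hq0 ha0 hb0 => ?_⟩
  · have hu := mt hr.eq_zero.2 hr0
    have hu' := mul_ne_zero_iff.1 hu
    have hu1 := neg_ne_zero.1 hu'.1
    have hu2 := hu'.2
    rw [hr.extInv_eq hu, ← EReal.coe_mul, EReal.coe_eq_coe_iff,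
      hx _ _ (by omega) (by omega) (by omega) (by omega),
      hx _ _ (by omega) (by omega) (by omega) (by omega), adj_lower_one, adj_self]
    field_simp
  · have hu := mt hqh.eq_zero.2 hq0
    have hu' := mul_ne_zero_iff.1 hu
    have hu1 := neg_ne_zero.1 hu'.1
    have hu2 := hu'.2
    have ha0 : a (k + 2) (k + 1) = 0 := by simpa [hu2] using hr.eq_zero.1 hr0
    obtain ⟨hs, hl⟩ := hsplit ha0
    refine ⟨hrh.abs_lt_top.2 hl, ?_⟩
    rw [hqh.extInv_eq hu, hrh.eq_coe hl, ← EReal.coe_mul, ← EReal.coe_mul, EReal.coe_eq_coe_iff,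
      hx _ _ (by omega) (by omega) (by omega) (by omega),
      hx _ _ (by omega) (by omega) (by omega) (by omega), adj_self, adj_self]
    field_simp
  · have ht : trail n a (k + 2) = 0 := by simpa [ha0] using hr.eq_zero.1 hr0
    have hn := hlast ht
    refine ⟨hn, ?_⟩
    rw [hx _ _ (by omega) (by omega) (by omega) (by omega),
      hx _ _ (by omega) (by omega) (by omega) (by omega), adj_self, adj_lower_two, hrec, ht]
    field_simp
    ring
  · have ht : trail n a (k + 2) = 0 := by simpa [hb0] using hqh.eq_zero.1 hq0
    have hn := hlast ht
    obtain ⟨hs, hl⟩ := hsplit ha0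
    refine ⟨hn, hrh.abs_lt_top.2 hl, ?_⟩
    rw [hrh.eq_coe hl, ← EReal.coe_mul, ← EReal.coe_mul, EReal.coe_eq_coe_iff,
      hx _ _ (by omega) (by omega) (by omega) (by omega),
      hx _ _ (by omega) (by omega) (by omega) (by omega), adj_self, adj_lower_one, hrec, ht]
    field_simp
    ring
  · exact start_diag ha h0 hx (by omega) (by omega) (by rw [ha0, mul_zero])

/-- No `0 / 0` and no `0 * ∞` occurs in the recurrences for the ratios. -/
theorem ratios_determinate (ha : IsBand n a) (h0 : trail n a 0 ≠ 0) :
    (2 ≤ n → a 1 1 = 0 → a 2 1 ≠ 0 ∧ a 1 2 ≠ 0) ∧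
    (2 ≤ n → a n n = 0 → a (n - 1) n ≠ 0 ∧ a n (n - 1) ≠ 0) ∧
    (∀ k, 1 < k → k < n → s a k = 0 → a (k + 1) k ≠ 0 ∧ a k (k + 1) ≠ 0) ∧
    (∀ k, 1 < k → k < n → t n a k = 0 → a (k - 1) k ≠ 0 ∧ a k (k - 1) ≠ 0) ∧
    (∀ k, 2 ≤ k → k ≤ n → (q a k).abs = ⊤ → a (k - 1) k ≠ 0) ∧
    (∀ k, 1 ≤ k → k + 1 ≤ n → (r n a k).abs = ⊤ → a k (k + 1) ≠ 0) := by
  have hS : ∀ k, 1 ≤ k → k < n → s a k = 0 → a (k + 1) k ≠ 0 ∧ a k (k + 1) ≠ 0 := by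
    intro k hk hkn h
    obtain ⟨k, rfl⟩ := Nat.exists_eq_add_of_le' hk
    have := of_lead_eq_zero ha h0 hkn.le
      ((isRatio_q ha h0 (show k < n by omega)).2.eq_zero.1 h)
    exact ⟨this.2.1, this.1⟩
  have hT : ∀ k, 1 < k → k ≤ n → t n a k = 0 → a (k - 1) k ≠ 0 ∧ a k (k - 1) ≠ 0 := by
    intro k hk hkn h
    obtain ⟨k, rfl⟩ := Nat.exists_eq_add_of_le' hk.le
    have := of_trail_eq_zero ha h0 (show k ≤ n by omega)
      ((isRatio_t ha h0 (show k < n by omega)).eq_zero.1 h)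
    exact ⟨this.1, this.2.1⟩
  refine ⟨fun hn h => hS 1 le_rfl hn (by simp [s, q, h]),
    fun hn h => hT n hn le_rfl (by simp [t, r_self, h]), fun k hk => hS k hk.le,
    fun k hk hkn => hT k hk hkn.le, fun k hk hkn h => ?_, fun k hk hkn h => ?_⟩
  · obtain ⟨k, rfl⟩ := Nat.exists_eq_add_of_le' hk
    exact (of_lead_eq_zero ha h0 (show k + 1 ≤ n by omega)
      ((isRatio_q ha h0 (show k + 1 < n by omega)).1.abs_eq_top.1 h)).1
  · exact (of_trail_eq_zero ha h0 (show k ≤ n by omega)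
      ((isRatio_r ha h0 (show k ≤ n by omega)).abs_eq_top.1 h)).1

end Formulas

/-! ### Loops -/

/-- Induction along an ascending loop: `I k` is the loop invariant before step `k`, and `c k`
bounds the cost of step `k`. -/
theorem forUp_induction {P : ℕ → Cmd} {lo hi : ℕ} (hle : lo ≤ hi + 1) (I : ℕ → Mem → Prop)
    (c : ℕ → ℕ) (h : ∀ k, lo ≤ k → k ≤ hi → ∀ m, I k m →
      I (k + 1) ((P k).run m) ∧ (P k).cost m ≤ c k) {m : Mem} (h0 : I lo m) :
    I (hi + 1) ((Cmd.forUp lo hi P).run m) ∧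
      (Cmd.forUp lo hi P).cost m ≤ ∑ k ∈ Ico lo (hi + 1), c k := by
  unfold Cmd.forUp
  obtain ⟨len, hlen⟩ : ∃ len, hi + 1 = lo + len := ⟨hi + 1 - lo, by omega⟩
  rw [hlen, Nat.add_sub_cancel_left]
  replace h : ∀ k, lo ≤ k → k < lo + len → ∀ m, I k m →
      I (k + 1) ((P k).run m) ∧ (P k).cost m ≤ c k := fun k h1 h2 => h k h1 (by omega)
  clear hlen hle
  induction len generalizing lo m with
  | zero => simpa [Cmd.block, Cmd.run, Cmd.cost] using h0
  | succ len ih =>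
    have h1 := h lo le_rfl (by omega) m h0
    have h2 := ih h1.1 fun k hk hk' => h k (by omega) (by omega)
    rw [List.range'_succ, sum_eq_sum_Ico_succ_bot (by omega), ← add_assoc, add_right_comm]
    exact ⟨h2.1, add_le_add h1.2 h2.2⟩

/-- Induction along a descending loop: `I (k + 1)` is the loop invariant before step `k`, and
`c k` bounds the cost of step `k`. -/
theorem forDown_induction {P : ℕ → Cmd} {lo hi : ℕ} (hle : lo ≤ hi + 1) (I : ℕ → Mem → Prop)
    (c : ℕ → ℕ) (h : ∀ k, lo ≤ k → k ≤ hi → ∀ m, I (k + 1) m →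
      I k ((P k).run m) ∧ (P k).cost m ≤ c k) {m : Mem} (h0 : I (hi + 1) m) :
    I lo ((Cmd.forDown hi lo P).run m) ∧
      (Cmd.forDown hi lo P).cost m ≤ ∑ k ∈ Ico lo (hi + 1), c k := by
  unfold Cmd.forDown
  obtain ⟨len, hlen⟩ : ∃ len, hi + 1 = lo + len := ⟨hi + 1 - lo, by omega⟩
  rw [hlen] at h0 ⊢
  rw [Nat.add_sub_cancel_left]
  replace h : ∀ k, lo ≤ k → k < lo + len → ∀ m, I (k + 1) m →
      I k ((P k).run m) ∧ (P k).cost m ≤ c k := fun k h1 h2 => h k h1 (by omega)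
  clear hlen hle
  induction len generalizing m with
  | zero => simpa [Cmd.block, Cmd.run, Cmd.cost] using h0
  | succ len ih =>
    have h1 := h (lo + len) (by omega) (by omega) m h0
    have h2 := ih h1.1 fun k hk hk' => h k (by omega) (by omega)
    rw [List.range'_concat, List.reverse_append, ← add_assoc, sum_Ico_succ_top (by omega),
      add_comm (∑ _ ∈ _, _), mul_comm 1, mul_one]
    exact ⟨h2.1, add_le_add h1.2 h2.2⟩

/-! ### The ratio phase of the algorithm -/

section Machine

variable {n : ℕ} {a x : ℕ → ℕ → ℝ} {m : Mem}

/-- State before step `k` of the upward recurrence. -/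
def UpRatios (a : ℕ → ℕ → ℝ) (k : ℕ) (m : Mem) : Prop :=
  (∀ i j, m (.a i j) = a i j) ∧ (∀ i, m (.r i) = 0) ∧
    (∀ j, 1 ≤ j → j ≤ k → m (.q j) = q a j) ∧ ∀ j, 2 ≤ j → j ≤ k → m (.rHat j) = rHat a j

/-- State of the downward recurrence in which the ratios `r_j` and `q̂_j` are known for `k ≤ j`;
the dummy value `r_n = 0` is included. -/
def Ratios (n : ℕ) (a : ℕ → ℕ → ℝ) (k : ℕ) (m : Mem) : Prop :=
  (∀ i j, m (.a i j) = a i j) ∧ (∀ j, 1 ≤ j → j ≤ n → m (.q j) = q a j) ∧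
    (∀ j, 2 ≤ j → j ≤ n → m (.rHat j) = rHat a j) ∧
    (∀ j, k ≤ j → j ≤ n → m (.r j) = r n a j) ∧ ∀ j, k ≤ j → j < n → m (.qHat j) = qHat n a j

theorem ratiosUp_spec {k : ℕ} (hk : 1 ≤ k) (h : UpRatios a k m) :
    UpRatios a (k + 1) ((ratiosUp k).run m) ∧ (ratiosUp k).cost m ≤ 6 := by
  obtain ⟨h1, h2, h3, h4⟩ := h
  have hq := h3 k hk le_rfl
  refine ⟨⟨fun i j => ?_, fun i => ?_, fun j hj hjk => ?_, fun j hj hjk => ?_⟩, ?_⟩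
  · simp [ratiosUp, Cmd.block, Cmd.run, h1]
  · simp [ratiosUp, Cmd.block, Cmd.run, h2]
  · rcases hjk.eq_or_lt with rfl | hjk
    · simp [ratiosUp, Cmd.block, Cmd.run, h1, hq, q_succ hk, s]
    · simp [ratiosUp, Cmd.block, Cmd.run, hjk.ne, h3 j hj (by omega)]
  · rcases hjk.eq_or_lt with rfl | hjk
    · simp [ratiosUp, Cmd.block, Cmd.run, h1, hq, rHat_succ hk, s]
    · simp [ratiosUp, Cmd.block, Cmd.run, hjk.ne, h4 j hj (by omega)]
  · simp [ratiosUp, Cmd.block, Cmd.cost]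

theorem ratiosDown_spec {k : ℕ} (hkn : k < n) (h : Ratios n a (k + 1) m) :
    Ratios n a k ((ratiosDown (k + 1)).run m) ∧ (ratiosDown (k + 1)).cost m ≤ 6 := by
  obtain ⟨h1, h2, h3, h4, h5⟩ := h
  have hr := h4 (k + 1) le_rfl hkn
  refine ⟨⟨fun i j => ?_, fun j hj hjn => ?_, fun j hj hjn => ?_, fun j hj hjn => ?_,
    fun j hj hjn => ?_⟩, ?_⟩
  · simp [ratiosDown, Cmd.block, Cmd.run, h1]
  · simp [ratiosDown, Cmd.block, Cmd.run, h2 j hj hjn]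
  · simp [ratiosDown, Cmd.block, Cmd.run, h3 j hj hjn]
  · rcases hj.eq_or_lt with rfl | hj
    · simp [ratiosDown, Cmd.block, Cmd.run, h1, hr, r_pred hkn, t]
    · simp [ratiosDown, Cmd.block, Cmd.run, hj.ne', h4 j hj (by omega)]
  · rcases hj.eq_or_lt with rfl | hj
    · simp [ratiosDown, Cmd.block, Cmd.run, h1, hr, qHat_pred hkn, t]
    · simp [ratiosDown, Cmd.block, Cmd.run, hj.ne', h5 j hj (by omega)]
  · simp [ratiosDown, Cmd.block, Cmd.cost]

theorem upRatios_load : UpRatios a 1 (load a) := by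
  refine ⟨fun i j => rfl, fun i => rfl, fun j hj hj1 => ?_, fun j hj hj1 => by omega⟩
  obtain rfl : j = 1 := by omega
  rfl

theorem UpRatios.ratios (h : UpRatios a n m) : Ratios n a n m := by
  obtain ⟨h1, h2, h3, h4⟩ := h
  refine ⟨h1, h3, h4, fun j hj hjn => ?_, fun j hj hjn => by omega⟩
  obtain rfl : j = n := by omega
  rw [h2, r_self]

/-! ### Correctness and cost of the column steps -/

/-- All ratios are in their registers, and the registers `x i j` with `W i j` hold the
corresponding entries of the inverse. -/
def Known (n : ℕ) (a x : ℕ → ℕ → ℝ) (W : ℕ → ℕ → Prop) (m : Mem) : Prop :=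
  Ratios n a 1 m ∧ ∀ i j, W i j → m (.x i j) = x i j

variable {W W' : ℕ → ℕ → Prop}

theorem Known.mono (h : Known n a x W m) (hW : ∀ i j, W' i j → W i j) : Known n a x W' m :=
  ⟨h.1, fun i j hij => h.2 i j (hW i j hij)⟩

theorem Known.update_p (h : Known n a x W m) (v : EReal) :
    Known n a x W (Function.update m .p v) := by
  simpa [Known, Ratios] using h

theorem Known.update_c (h : Known n a x W m) (v : EReal) :
    Known n a x W (Function.update m .c v) := by
  simpa [Known, Ratios] using h

theorem Known.update_x (h : Known n a x W m) {i j : ℕ} {v : EReal} (hv : v = x i j) :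
    Known n a x (fun i' j' => W i' j' ∨ (i' = i ∧ j' = j)) (Function.update m (.x i j) v) := by
  refine ⟨by simpa [Ratios] using h.1, fun i' j' hij => ?_⟩
  by_cases hc : i' = i ∧ j' = j
  · obtain ⟨rfl, rfl⟩ := hc
    simpa using hv
  · have hne : Reg.x i' j' ≠ .x i j := by simpa using hc
    rw [Function.update_of_ne hne]
    exact h.2 _ _ (hij.resolve_right hc)

/-- The loop that computes part of column `j'` as a multiple of column `j`; the coefficient is in
the register `y`. -/
theorem scaleColumn_spec {y : Reg} {lo hi j j' : ℕ} (hle : lo ≤ hi + 1)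
    (hy : ∀ i j, y ≠ .x i j)
    (hW : ∀ s, lo ≤ s → s ≤ hi → W s j)
    (hval : ∀ s, lo ≤ s → s ≤ hi → (x s j' : EReal) = m y * x s j) (h : Known n a x W m) :
    Known n a x (fun i' j₁ => W i' j₁ ∨ (j₁ = j' ∧ lo ≤ i' ∧ i' ≤ hi))
      ((Cmd.forUp lo hi fun s => .mul (.x s j') y (.x s j)).run m) ∧
    (Cmd.forUp lo hi fun s => .mul (.x s j') y (.x s j)).cost m ≤ hi + 1 - lo := by
  have key := forUp_induction (P := fun s => .mul (.x s j') y (.x s j)) hle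
    (fun k m' => Known n a x (fun i' j₁ => W i' j₁ ∨ (j₁ = j' ∧ lo ≤ i' ∧ i' < k)) m' ∧
      m' y = m y) (fun _ => 1) (fun k hk hk' m' hm' => ?_) (m := m)
      ⟨h.mono fun i' j₁ h' => h'.resolve_right (by omega), rfl⟩
  · refine ⟨key.1.1.mono fun i' j₁ h' => ?_, by simpa using key.2⟩
    rcases h' with h' | h'
    · exact Or.inl h'
    · exact Or.inr (by omega)
  · refine ⟨⟨(hm'.1.update_x (i := k) (j := j') (v := m' y * m' (.x k j)) ?_).mono ?_, ?_⟩, le_rfl⟩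
    · rw [hm'.2, hm'.1.2 k j (Or.inl (hW k hk hk')), hval k hk hk']
    · rintro i' j₁ (h' | h')
      · exact Or.inl (Or.inl h')
      · by_cases hik : i' = k
        · exact Or.inr ⟨hik, h'.1⟩
        · exact Or.inl (Or.inr (by omega))
    · simp [Cmd.run, hy, hm'.2]

theorem extInv_coe {b : ℝ} (hb : b ≠ 0) : extInv b = ((b⁻¹ : ℝ) : EReal) := by
  have := extDiv_coe_of_ne_zero 1 hb
  rwa [one_div] at this

theorem startDiag_spec (h : Known n a x W m) {k : ℕ} (hk : 1 ≤ k) (hkn : k ≤ n)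
    (hval : (x k k : EReal) = extInv (a (k - 1) k * q a k + a k k)) :
    Known n a x (fun i j => W i j ∨ (i = k ∧ j = k)) ((startDiag k).run m) := by
  simp only [startDiag, Cmd.block, Cmd.run]
  refine ((h.update_p _).update_p _).update_x ?_
  simp [h.1.1, h.1.2.1 k hk hkn, hval]

theorem lowerMissing_spec (ha : IsBand n a) (h0 : trail n a 0 ≠ 0) (hx : IsInverse n a x)
    {k : ℕ} (hk : 2 ≤ k) (hkn : k < n) (hq : (q a k).abs = ⊤) (h : Known n a x W m)
    (hW : ∀ i j, k - 1 ≤ j → j ≤ i → i ≤ n → k < i → W i j) :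
    Known n a x (fun i j => W i j ∨ (i = k ∧ j = k - 1)) ((lowerMissing k).run m) := by
  obtain ⟨f1, f2, f3, f4, f5⟩ := lower_missing ha h0 hx hk hkn hq
  have hb := (lower_of_infinite ha h0 hx hk hkn.le hq).1
  have hr := h.1.2.2.2.1 k (by omega) hkn.le
  have hqh := h.1.2.2.2.2 k (by omega) hkn
  have ha' := h.1.1
  simp only [lowerMissing, negQuotMul, Cmd.block, Cmd.run, hr, hqh, ha', EReal.coe_eq_zero]
  split_ifs with c1 c2 c3 c4
  · refine h.update_x ?_
    rw [f5 c1 c2 c3 c4, extInv_coe hb]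
  · obtain ⟨hn, f⟩ := f4 c1 c2 c3 c4
    refine (h.update_c _).update_x ?_
    simp only [Function.update_self, ne_eq, reduceCtorEq, not_false_eq_true, Function.update_of_ne]
    rw [h.2 _ _ (hW _ _ (by omega) (by omega) (by omega) (by omega)), extDiv_coe_of_ne_zero _ hb, f,
      ← EReal.coe_mul, div_eq_mul_inv]
  · refine ((((h.update_c _).update_c _).update_p _).update_c _).update_x ?_
    simp only [Function.update_self, ne_eq, reduceCtorEq, not_false_eq_true, Function.update_of_ne]
    rw [h.2 _ _ (hW _ _ (by omega) (by omega) (by omega) (by omega)), extDiv_coe_of_ne_zero _ hb,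
      f3 c1 c2 c3, ← EReal.coe_neg, hqh, neg_mul, div_eq_mul_inv]
  · obtain ⟨hn, f⟩ := f2 c1 c2
    refine ((h.update_c _).update_c _).update_x ?_
    simp only [Function.update_self, ne_eq, reduceCtorEq, not_false_eq_true, Function.update_of_ne]
    rw [h.2 _ _ (hW _ _ (by omega) (by omega) (by omega) (by omega)), extDiv_coe_of_ne_zero _ c2,
      f, ← EReal.coe_neg, ← EReal.coe_mul, neg_mul (a _ _), div_eq_mul_inv]
  · refine (h.update_c _).update_x ?_
    simp only [Function.update_self, ne_eq, reduceCtorEq, not_false_eq_true, Function.update_of_ne]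
    rw [h.2 _ _ (hW _ _ (by omega) (by omega) (by omega) (by omega)), f1 c1]

theorem lowerMissing_cost_le (k : ℕ) (m : Mem) : (lowerMissing k).cost m ≤ 9 := by
  simp only [lowerMissing, negQuotMul, Cmd.block, Cmd.cost]
  split_ifs <;> omega

theorem upperMissing_cost_le (k : ℕ) (m : Mem) : (upperMissing k).cost m ≤ 9 := by
  simp only [upperMissing, negQuotMul, Cmd.block, Cmd.cost]
  split_ifs <;> omega

theorem diagonal_cost_le (k : ℕ) (m : Mem) : (diagonal k).cost m ≤ 8 := by
  simp only [diagonal, startDiag, negQuotMul, Cmd.block, Cmd.cost]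
  split_ifs <;> omega

/-- The step for the lower part of column `k - 1`, given the lower parts of the later columns. -/
theorem lowerColumn_spec (ha : IsBand n a) (h0 : trail n a 0 ≠ 0) (hx : IsInverse n a x)
    {k : ℕ} (hk : 2 ≤ k) (hkn : k ≤ n) (h : Known n a x W m)
    (hW : ∀ i j, k ≤ j → j ≤ i → i ≤ n → W i j) :
    Known n a x (fun i j => W i j ∨ (j = k - 1 ∧ k ≤ i ∧ i ≤ n)) ((lowerColumn n k).run m) ∧
      (lowerColumn n k).cost m ≤ n + 1 - k + 12 := by
  have hq := h.1.2.1 k (by omega) hkn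
  simp only [lowerColumn, Cmd.run, Cmd.cost, hq]
  by_cases hinf : (q a k).abs = ⊤
  · rw [if_pos hinf, if_pos hinf]
    obtain ⟨hb, hkk, hf⟩ := lower_of_infinite ha h0 hx hk hkn hinf
    by_cases hkn' : k = n
    · subst hkn'
      simp only [if_true, Cmd.run, Cmd.cost]
      refine ⟨(h.update_x (i := k) (j := k - 1) ?_).mono ?_, by omega⟩
      · rw [h.1.1, extInv_coe hb, hkk]
      · rintro i j (h' | h')
        · exact Or.inl h'
        · exact Or.inr (by omega)
    · simp only [if_neg hkn', Cmd.block, Cmd.run, Cmd.cost]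
      set m₁ := Function.update (Function.update m .c (extDiv (m (.a (k + 1) k)) (m (.a (k - 1) k))))
        .c (-(Function.update m .c (extDiv (m (.a (k + 1) k)) (m (.a (k - 1) k)))) .c) with hm₁
      have hc : m₁ .c = ((-a (k + 1) k * (a (k - 1) k)⁻¹ : ℝ) : EReal) := by
        simp only [hm₁, Function.update_self, h.1.1]
        rw [extDiv_coe_of_ne_zero _ hb, ← EReal.coe_neg, neg_mul, div_eq_mul_inv]
      have h1 : Known n a x W m₁ := (h.update_c _).update_c _
      have h2 := scaleColumn_spec (m := m₁) (y := .c) (lo := k + 1) (hi := n) (j := k + 1)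
        (j' := k - 1) (by omega) (by simp)
        (fun s hs hsn => hW s (k + 1) (by omega) (by omega) hsn)
        (fun s hs hsn => by rw [hc, ← EReal.coe_mul, hf s hs hsn]) h1
      have h3 := lowerMissing_spec ha h0 hx hk (by omega) hinf h2.1 (fun i j hj hji hin hki => by
        by_cases hjk : k ≤ j
        · exact Or.inl (hW i j hjk hji hin)
        · exact Or.inr (by omega))
      refine ⟨h3.mono ?_, ?_⟩
      · rintro i j (h' | h')
        · exact Or.inl (Or.inl h')
        · by_cases hik : i = k
          · exact Or.inr ⟨hik, h'.1⟩
          · exact Or.inl (Or.inr (by omega))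
      · have h4 := lowerMissing_cost_le k ((Cmd.forUp (k + 1) n fun s =>
          .mul (.x s (k - 1)) .c (.x s (k + 1))).run m₁)
        have h5 := h2.2
        omega
  · rw [if_neg hinf, if_neg hinf]
    have h1 := scaleColumn_spec (m := m) (y := .q k) (lo := k) (hi := n) (j := k)
      (j' := k - 1) (by omega) (by simp) (fun s hs hsn => hW s k le_rfl hs hsn)
      (fun s hs hsn => by
        rw [hq, lower_of_finite ha h0 hx hk hkn (lt_top_iff_ne_top.2 hinf) hs hsn]) h
    have h2 := h1.2
    exact ⟨h1.1, by omega⟩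

theorem diagonal_spec (ha : IsBand n a) (h0 : trail n a 0 ≠ 0) (hx : IsInverse n a x)
    {k : ℕ} (hk : 2 ≤ k) (hkn : k ≤ n) (h : Known n a x W m)
    (hW : ∀ i j, k - 1 ≤ j → j ≤ i → i ≤ n → k ≤ i → W i j) :
    Known n a x (fun i j => W i j ∨ (i = k - 1 ∧ j = k - 1)) ((diagonal k).run m) := by
  obtain ⟨f1, f2, f3, f4, f5⟩ := diagonal_formula ha h0 hx hk hkn
  have hr := h.1.2.2.2.1 (k - 1) (by omega) (by omega)
  have hqh := h.1.2.2.2.2 (k - 1) (by omega) (by omega)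
  have hrh := h.1.2.2.1 k hk hkn
  have ha' := h.1.1
  have hstart := fun hval => startDiag_spec h (k := k - 1) (by omega) (by omega) hval
  simp only [diagonal, negQuotMul, Cmd.block, Cmd.run, hr, hqh, ha', EReal.coe_eq_zero]
  split_ifs with c1 c2 c3 c4
  · exact hstart (f5 c1 c2 c3 c4)
  · obtain ⟨hn, -, f⟩ := f4 c1 c2 c3 c4
    refine (((h.update_c _).update_c _).update_c _).update_x ?_
    simp only [Function.update_self, ne_eq, reduceCtorEq, not_false_eq_true, Function.update_of_ne]
    rw [h.2 _ _ (hW _ _ (by omega) (by omega) (by omega) (by omega)),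
      extDiv_coe_of_ne_zero _ c4, f, ← EReal.coe_neg, hrh, neg_mul (a _ _), div_eq_mul_inv]
  · obtain ⟨hn, f⟩ := f3 c1 c2 c3
    refine ((h.update_c _).update_c _).update_x ?_
    simp only [Function.update_self, ne_eq, reduceCtorEq, not_false_eq_true, Function.update_of_ne]
    rw [h.2 _ _ (hW _ _ (by omega) (by omega) (by omega) (by omega)), extDiv_coe_of_ne_zero _ c3,
      f, ← EReal.coe_neg, ← EReal.coe_mul, neg_mul (a _ _), div_eq_mul_inv]
  · refine ((h.update_c _).update_c _).update_x ?_
    simp only [Function.update_self, ne_eq, reduceCtorEq, not_false_eq_true, Function.update_of_ne]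
    rw [h.2 _ _ (hW _ _ (by omega) (by omega) (by omega) (by omega)), (f2 c1 c2).2, hrh]
  · refine (h.update_c _).update_x ?_
    simp only [Function.update_self, ne_eq, reduceCtorEq, not_false_eq_true, Function.update_of_ne]
    rw [h.2 _ _ (hW _ _ (by omega) (by omega) (by omega) (by omega)), f1 c1]

theorem upperMissing_spec (ha : IsBand n a) (h0 : trail n a 0 ≠ 0) (hx : IsInverse n a x)
    {k : ℕ} (hk : 1 < k) (hkn : k + 1 ≤ n) (hq : (qHat n a k).abs = ⊤) (h : Known n a x W m)
    (hW : ∀ i j, 1 ≤ i → 1 ≤ j → i ≤ n → j ≤ k + 1 → i < k ∨ j ≤ i → W i j) :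
    Known n a x (fun i j => W i j ∨ (i = k ∧ j = k + 1)) ((upperMissing k).run m) := by
  obtain ⟨f1, f2, f3, f4, f5⟩ := upper_missing ha h0 hx hk hkn hq
  have hb := (upper_of_infinite ha h0 hx hk.le hkn hq).1
  have hr := h.1.2.2.1 k (by omega) (by omega)
  have hqq := h.1.2.1 k (by omega) (by omega)
  have ha' := h.1.1
  simp only [upperMissing, negQuotMul, Cmd.block, Cmd.run, hr, hqq, ha', EReal.coe_eq_zero]
  split_ifs with c1 c2 c3 c4
  · refine (h.update_c _).update_x ?_
    simp only [Function.update_self, ne_eq, reduceCtorEq, not_false_eq_true, Function.update_of_ne]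
    rw [h.2 _ _ (hW _ _ (by omega) (by omega) (by omega) (by omega) (by omega)),
      extDiv_coe_of_ne_zero _ hb, f5 c1 c2 c3 c4, ← EReal.coe_mul, div_eq_mul_inv]
  · obtain ⟨hn, f⟩ := f4 c1 c2 c3 c4
    refine (h.update_c _).update_x ?_
    simp only [Function.update_self, ne_eq, reduceCtorEq, not_false_eq_true, Function.update_of_ne]
    rw [h.2 _ _ (hW _ _ (by omega) (by omega) (by omega) (by omega) (by omega)),
      extDiv_coe_of_ne_zero _ hb, f, ← EReal.coe_mul, div_eq_mul_inv]
  · refine ((((h.update_c _).update_c _).update_p _).update_c _).update_x ?_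
    simp only [Function.update_self, ne_eq, reduceCtorEq, not_false_eq_true, Function.update_of_ne]
    rw [h.2 _ _ (hW _ _ (by omega) (by omega) (by omega) (by omega) (by omega)),
      extDiv_coe_of_ne_zero _ hb, f3 c1 c2 c3, ← EReal.coe_neg, hqq, neg_mul, div_eq_mul_inv]
  · obtain ⟨hn, f⟩ := f2 c1 c2
    refine ((h.update_c _).update_c _).update_x ?_
    simp only [Function.update_self, ne_eq, reduceCtorEq, not_false_eq_true, Function.update_of_ne]
    rw [h.2 _ _ (hW _ _ (by omega) (by omega) (by omega) (by omega) (by omega)),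
      extDiv_coe_of_ne_zero _ c2, f, ← EReal.coe_neg, ← EReal.coe_mul, neg_mul (a _ _),
      div_eq_mul_inv]
  · refine (h.update_c _).update_x ?_
    simp only [Function.update_self, ne_eq, reduceCtorEq, not_false_eq_true, Function.update_of_ne]
    rw [h.2 _ _ (hW _ _ (by omega) (by omega) (by omega) (by omega) (by omega)), f1 c1]

/-- The step for the upper part of column `k + 1`, given the lower triangle and the upper parts of
the earlier columns. -/
theorem upperColumn_spec (ha : IsBand n a) (h0 : trail n a 0 ≠ 0) (hx : IsInverse n a x)
    {k : ℕ} (hk : 1 ≤ k) (hkn : k + 1 ≤ n) (h : Known n a x W m)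
    (hW : ∀ i j, 1 ≤ i → 1 ≤ j → i ≤ n → j ≤ n → j ≤ k ∨ j ≤ i → W i j) :
    Known n a x (fun i j => W i j ∨ (j = k + 1 ∧ 1 ≤ i ∧ i ≤ k)) ((upperColumn k).run m) ∧
      (upperColumn k).cost m ≤ k + 12 := by
  have hq := h.1.2.2.2.2 k hk hkn
  simp only [upperColumn, Cmd.run, Cmd.cost, hq]
  by_cases hinf : (qHat n a k).abs = ⊤
  · rw [if_pos hinf, if_pos hinf]
    obtain ⟨hb, -, hkk, hf⟩ := upper_of_infinite ha h0 hx hk hkn hinf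
    by_cases hk1 : k = 1
    · subst hk1
      simp only [if_true, Cmd.block, Cmd.run, Cmd.cost]
      refine ⟨((h.update_c _).update_x (i := 1) (j := 2) ?_).mono ?_, by omega⟩
      · simp only [Function.update_self, ne_eq, reduceCtorEq, not_false_eq_true,
          Function.update_of_ne, h.1.1]
        rw [extDiv_coe_of_ne_zero _ hb, h.2 2 1 (hW _ _ (by omega) (by omega) (by omega) (by omega)
          (by omega)), ← EReal.coe_mul, hkk, div_eq_mul_inv]
      · rintro i j (h' | h')
        · exact Or.inl h'
        · exact Or.inr (by omega)
    · simp only [if_neg hk1, Cmd.block, Cmd.run, Cmd.cost]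
      set m₁ := Function.update (Function.update m .c (extDiv (m (.a (k - 1) k)) (m (.a (k + 1) k))))
        .c (-(Function.update m .c (extDiv (m (.a (k - 1) k)) (m (.a (k + 1) k)))) .c) with hm₁
      have hc : m₁ .c = ((-a (k - 1) k * (a (k + 1) k)⁻¹ : ℝ) : EReal) := by
        simp only [hm₁, Function.update_self, h.1.1]
        rw [extDiv_coe_of_ne_zero _ hb, ← EReal.coe_neg, neg_mul, div_eq_mul_inv]
      have h1 : Known n a x W m₁ := (h.update_c _).update_c _
      have h2 := scaleColumn_spec (m := m₁) (y := .c) (lo := 1) (hi := k - 1) (j := k - 1)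
        (j' := k + 1) (by omega) (by simp)
        (fun s hs hsk => hW s (k - 1) hs (by omega) (by omega) (by omega) (by omega))
        (fun s hs hsk => by rw [hc, ← EReal.coe_mul, hf s hs (by omega)]) h1
      have h3 := upperMissing_spec ha h0 hx (by omega) hkn hinf h2.1
        (fun i j hi hj hin hjk hij => by
          by_cases hjk' : j ≤ k ∨ j ≤ i
          · exact Or.inl (hW i j hi hj hin (by omega) hjk')
          · exact Or.inr (by omega))
      refine ⟨h3.mono ?_, ?_⟩
      · rintro i j (h' | h')
        · exact Or.inl (Or.inl h')
        · by_cases hik : i = k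
          · exact Or.inr ⟨hik, h'.1⟩
          · exact Or.inl (Or.inr (by omega))
      · have h4 := upperMissing_cost_le k ((Cmd.forUp 1 (k - 1) fun s =>
          .mul (.x s (k + 1)) .c (.x s (k - 1))).run m₁)
        have h5 := h2.2
        omega
  · rw [if_neg hinf, if_neg hinf]
    have h1 := scaleColumn_spec (m := m) (y := .qHat k) (lo := 1) (hi := k) (j := k)
      (j' := k + 1) (by omega) (by simp)
      (fun s hs hsk => hW s k hs hk (by omega) (by omega) (Or.inl le_rfl))
      (fun s hs hsk => by
        rw [hq, upper_of_finite ha h0 hx hk hkn (lt_top_iff_ne_top.2 hinf) hs hsk]) h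
    have h2 := h1.2
    exact ⟨h1.1, by omega⟩

/-! ### The whole algorithm -/

/-- The two triangles together take `n (n - 1)` multiplications up to a linear term. -/
theorem sum_column_costs_le (n : ℕ) :
    ∑ k ∈ Ico 2 (n + 1), (n + 1 - k + 20) + ∑ k ∈ Ico 1 (n - 1 + 1), (k + 12) ≤
      n ^ 2 + 32 * n := by
  rcases n with _ | n
  · simp
  rw [Nat.add_sub_cancel, sum_Ico_eq_sum_range, sum_Ico_eq_sum_range,
    show n + 1 + 1 - 2 = n by omega, show n + 1 - 1 = n by omega, ← sum_add_distrib,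
    sum_congr rfl (g := fun _ => n + 33) fun i hi => by
      have := mem_range.1 hi
      omega]
  simp only [sum_const, card_range, smul_eq_mul]
  nlinarith

/-- Correctness and cost. The linear term `47 n` collects `6 n` for each ratio recurrence, `3` for
the starting element and `32 n` from `sum_column_costs_le`. -/
theorem ratioInversion_spec (ha : IsBand n a) (h0 : trail n a 0 ≠ 0) (hx : IsInverse n a x)
    (hn : 1 ≤ n) :
    (∀ i j, 1 ≤ i → i ≤ n → 1 ≤ j → j ≤ n →
      (ratioInversion n).run (load a) (.x i j) = x i j) ∧
      (ratioInversion n).cost (load a) ≤ n ^ 2 + 47 * n := by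
  simp only [ratioInversion, Cmd.block, Cmd.run, Cmd.cost]
  have h1 := forUp_induction (lo := 1) (hi := n - 1) (P := ratiosUp) (by omega) (UpRatios a)
    (fun _ => 6) (fun k hk _ m hm => ratiosUp_spec hk hm) upRatios_load
  set m₁ := (Cmd.forUp 1 (n - 1) ratiosUp).run (load a)
  rw [Nat.sub_add_cancel hn] at h1
  have h2 := forDown_induction (lo := 2) (hi := n) (P := ratiosDown) (by omega)
    (fun k => Ratios n a (k - 1)) (fun _ => 6) (fun k hk hkn m hm => by
      obtain ⟨k, rfl⟩ := Nat.exists_eq_add_of_le' (show 1 ≤ k by omega)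
      exact ratiosDown_spec hkn hm) (m := m₁) h1.1.ratios
  set m₂ := (Cmd.forDown n 2 ratiosDown).run m₁
  have h3 : Known n a x (fun _ _ => False) m₂ := ⟨h2.1, fun _ _ h => h.elim⟩
  have h4 := startDiag_spec h3 hn le_rfl
    (start_diag ha h0 hx hn le_rfl (by rw [ha.outside n (n + 1) (by omega), zero_mul]))
  have h4' : (startDiag n).cost m₂ = 3 := rfl
  set m₃ := (startDiag n).run m₂
  have h5 := forDown_induction (lo := 2) (hi := n)
    (P := fun k => .seq (lowerColumn n k) (diagonal k)) (by omega)
    -- `forDown_induction` attaches `k + 1` to the state before step `k`, where columns `≥ k` are known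
    (fun k => Known n a x fun i j => k - 1 ≤ j ∧ j ≤ i ∧ i ≤ n) (fun k => n + 1 - k + 20)
    (fun k hk hkn m hm => by
      have e1 := lowerColumn_spec ha h0 hx hk hkn hm fun i j hj hji hin => ⟨by omega, hji, hin⟩
      have e2 := diagonal_spec ha h0 hx hk hkn e1.1 fun i j hj hji hin hki => by omega
      have e3 := diagonal_cost_le k ((lowerColumn n k).run m)
      refine ⟨e2.mono fun i j h => by omega, ?_⟩
      have := e1.2
      simp only [Cmd.cost]
      omega) (m := m₃) (h4.mono fun i j h => by omega)
  set m₄ := (Cmd.forDown n 2 fun k => .seq (lowerColumn n k) (diagonal k)).run m₃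
  have h6 := forUp_induction (lo := 1) (hi := n - 1) (P := upperColumn) (by omega)
    (fun k => Known n a x fun i j => 1 ≤ i ∧ 1 ≤ j ∧ i ≤ n ∧ j ≤ n ∧ (j ≤ k ∨ j ≤ i))
    (fun k => k + 12)
    (fun k hk hkn m hm => by
      have e1 := upperColumn_spec ha h0 hx hk (by omega) hm
        fun i j hi hj hin hjn hij => ⟨hi, hj, hin, hjn, hij⟩
      exact ⟨e1.1.mono fun i j h => by omega, e1.2⟩) (m := m₄) (h5.1.mono fun i j h => by omega)
  refine ⟨fun i j hi hin hj hjn => h6.1.2 i j ⟨hi, hj, hin, hjn, by omega⟩, ?_⟩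
  have c1 := h1.2
  have c2 := h2.2
  have c5 := h5.2
  have c6 := h6.2
  have c := sum_column_costs_le n
  simp only [sum_const, Nat.card_Ico, smul_eq_mul] at c1 c2
  rw [show n - 1 + 1 = n by omega] at c c6
  omega

end Machine

end TridiagInv

theorem theorem3p2 :
    -- the ratios are well defined and satisfy all the formulas
    (∀ (n : ℕ) (A : Matrix (Fin n) (Fin n) ℝ), TridiagInv.IsTridiagonal A → IsUnit A.det →
      ∀ a x : ℕ → ℕ → ℝ, a = TridiagInv.entry A → x = TridiagInv.entry A⁻¹ →
      ∀ q rHat qHat r : ℕ → EReal, q = TridiagInv.q a → rHat = TridiagInv.rHat a →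
        qHat = TridiagInv.qHat n a → r = TridiagInv.r n a →
      -- no `0 / 0` and no `0 * ∞` occurs in the recurrences for the ratios
      ((2 ≤ n → a 1 1 = 0 → a 2 1 ≠ 0 ∧ a 1 2 ≠ 0) ∧
        (2 ≤ n → a n n = 0 → a (n - 1) n ≠ 0 ∧ a n (n - 1) ≠ 0) ∧
        (∀ k, 1 < k → k < n → TridiagInv.s a k = 0 → a (k + 1) k ≠ 0 ∧ a k (k + 1) ≠ 0) ∧
        (∀ k, 1 < k → k < n → TridiagInv.t n a k = 0 → a (k - 1) k ≠ 0 ∧ a k (k - 1) ≠ 0) ∧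
        (∀ k, 2 ≤ k → k ≤ n → (q k).abs = ⊤ → a (k - 1) k ≠ 0) ∧
        (∀ k, 1 ≤ k → k + 1 ≤ n → (r k).abs = ⊤ → a k (k + 1) ≠ 0)) ∧
      -- a)
      (∀ k, 2 ≤ k → k ≤ n →
        ((q k).abs < ⊤ → ∀ s, k ≤ s → s ≤ n →
          (x s (k - 1) : EReal) = q k * (x s k : EReal)) ∧
        ((q k).abs = ⊤ →
          a (k - 1) k ≠ 0 ∧
          (k = n → x n (n - 1) = (a (n - 1) n)⁻¹) ∧
          (k < n → ∀ s, k < s → s ≤ n →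
            x s (k - 1) = -a (k + 1) k * (a (k - 1) k)⁻¹ * x s (k + 1)) ∧
          (k < n →
            (r k ≠ 0 →
              (x k (k - 1) : EReal) = TridiagInv.extInv (r k) * (x (k + 1) (k - 1) : EReal)) ∧
            (r k = 0 → a (k + 1) k ≠ 0 → k + 2 ≤ n ∧
              x k (k - 1) = -a (k + 1) (k + 2) * (a (k + 1) k)⁻¹ * x (k + 2) (k - 1)) ∧
            (r k = 0 → a (k + 1) k = 0 → qHat k ≠ 0 →
              (x k (k - 1) : EReal) = ((-a k (k + 1) * (a (k - 1) k)⁻¹ : ℝ) : EReal) *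
                TridiagInv.extInv (qHat k) * (x (k + 1) (k + 1) : EReal)) ∧
            (r k = 0 → a (k + 1) k = 0 → qHat k = 0 → a k (k + 1) ≠ 0 → k + 2 ≤ n ∧
              x k (k - 1) = a (k + 1) (k + 2) * (a (k - 1) k)⁻¹ * x (k + 2) (k + 1)) ∧
            (r k = 0 → a (k + 1) k = 0 → qHat k = 0 → a k (k + 1) = 0 →
              x k (k - 1) = (a (k - 1) k)⁻¹)))) ∧
      -- b)
      (∀ k, 2 ≤ k → k ≤ n →
        (r (k - 1) ≠ 0 →
          (x (k - 1) (k - 1) : EReal) =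
            TridiagInv.extInv (r (k - 1)) * (x k (k - 1) : EReal)) ∧
        (r (k - 1) = 0 → qHat (k - 1) ≠ 0 → (rHat k).abs < ⊤ ∧
          (x (k - 1) (k - 1) : EReal) =
            rHat k * TridiagInv.extInv (qHat (k - 1)) * (x k k : EReal)) ∧
        (r (k - 1) = 0 → qHat (k - 1) = 0 → a k (k - 1) ≠ 0 → k + 1 ≤ n ∧
          x (k - 1) (k - 1) = -a k (k + 1) * (a k (k - 1))⁻¹ * x (k + 1) (k - 1)) ∧
        (r (k - 1) = 0 → qHat (k - 1) = 0 → a k (k - 1) = 0 → a (k - 1) k ≠ 0 →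
          k + 1 ≤ n ∧ (rHat k).abs < ⊤ ∧
          (x (k - 1) (k - 1) : EReal) = ((-a k (k + 1) * (a (k - 1) k)⁻¹ : ℝ) : EReal) *
            rHat k * (x (k + 1) k : EReal)) ∧
        (r (k - 1) = 0 → qHat (k - 1) = 0 → a k (k - 1) = 0 → a (k - 1) k = 0 →
          (x (k - 1) (k - 1) : EReal) = TridiagInv.extInv
            ((a (k - 2) (k - 1) : EReal) * q (k - 1) + (a (k - 1) (k - 1) : EReal)))) ∧
      -- c)
      (∀ k, 1 ≤ k → k + 1 ≤ n →
        ((qHat k).abs < ⊤ → ∀ s, 1 ≤ s → s ≤ k →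
          (x s (k + 1) : EReal) = qHat k * (x s k : EReal)) ∧
        ((qHat k).abs = ⊤ →
          a (k + 1) k ≠ 0 ∧
          (k = 1 → x 1 2 = a 1 2 * (a 2 1)⁻¹ * x 2 1) ∧
          (1 < k → ∀ s, 1 ≤ s → s < k →
            x s (k + 1) = -a (k - 1) k * (a (k + 1) k)⁻¹ * x s (k - 1)) ∧
          (1 < k →
            (rHat k ≠ 0 →
              (x k (k + 1) : EReal) = TridiagInv.extInv (rHat k) * (x (k - 1) (k + 1) : EReal)) ∧
            (rHat k = 0 → a (k - 1) k ≠ 0 → 3 ≤ k ∧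
              x k (k + 1) = -a (k - 1) (k - 2) * (a (k - 1) k)⁻¹ * x (k - 2) (k + 1)) ∧
            (rHat k = 0 → a (k - 1) k = 0 → q k ≠ 0 →
              (x k (k + 1) : EReal) = ((-a k (k - 1) * (a (k + 1) k)⁻¹ : ℝ) : EReal) *
                TridiagInv.extInv (q k) * (x (k - 1) (k - 1) : EReal)) ∧
            (rHat k = 0 → a (k - 1) k = 0 → q k = 0 → a k (k - 1) ≠ 0 → 3 ≤ k ∧
              x k (k + 1) = a (k - 1) (k - 2) * (a (k + 1) k)⁻¹ * x (k - 2) (k - 1)) ∧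
            (rHat k = 0 → a (k - 1) k = 0 → q k = 0 → a k (k - 1) = 0 →
              x k (k + 1) = a k (k + 1) * (a (k + 1) k)⁻¹ * x (k + 1) k))))) ∧
    -- the algorithm given by the formulas inverts `A` in `n ^ 2 + O(n)` operations
    (∃ C : ℕ, ∀ n : ℕ, 1 ≤ n → ∀ A : Matrix (Fin n) (Fin n) ℝ,
      TridiagInv.IsTridiagonal A → IsUnit A.det →
      (∀ i j, 1 ≤ i → i ≤ n → 1 ≤ j → j ≤ n →
        (TridiagInv.ratioInversion n).run (TridiagInv.load (TridiagInv.entry A))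
          (TridiagInv.Reg.x i j) = (TridiagInv.entry A⁻¹ i j : EReal)) ∧
      (TridiagInv.ratioInversion n).cost (TridiagInv.load (TridiagInv.entry A)) ≤
        n ^ 2 + C * n) := by
  refine ⟨?_, 47, fun n hn A hA hdet => ?_⟩
  · rintro n A hA hdet a x rfl rfl q rHat qHat r rfl rfl rfl rfl
    have ha := TridiagInv.isBand_entry hA
    have h0 : TridiagInv.trail n (TridiagInv.entry A) 0 ≠ 0 := by
      rw [TridiagInv.trail_entry_zero]
      exact hdet.ne_zero
    have hx : TridiagInv.IsInverse n (TridiagInv.entry A) (TridiagInv.entry A⁻¹) :=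
      fun i j => TridiagInv.entry_inv hA hdet
    refine ⟨TridiagInv.ratios_determinate ha h0, fun k hk hkn => ⟨fun hq s hs hsn =>
      TridiagInv.lower_of_finite ha h0 hx hk hkn hq hs hsn, fun hq => ?_⟩,
      fun k hk hkn => TridiagInv.diagonal_formula ha h0 hx hk hkn, fun k hk hkn =>
      ⟨fun hq s hs hsk => TridiagInv.upper_of_finite ha h0 hx hk hkn hq hs hsk, fun hq => ?_⟩⟩
    · obtain ⟨h1, h2, h3⟩ := TridiagInv.lower_of_infinite ha h0 hx hk hkn hq
      exact ⟨h1, fun h => h ▸ h2, fun _ => h3,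
        fun hkn => TridiagInv.lower_missing ha h0 hx hk hkn hq⟩
    · obtain ⟨h1, -, h2, h3⟩ := TridiagInv.upper_of_infinite ha h0 hx hk hkn hq
      exact ⟨h1, fun h => by subst h; exact h2, fun _ => h3,
        fun hk => TridiagInv.upper_missing ha h0 hx hk hkn hq⟩
  · refine TridiagInv.ratioInversion_spec (TridiagInv.isBand_entry hA) ?_
      (fun i j => TridiagInv.entry_inv hA hdet) hn
    rw [TridiagInv.trail_entry_zero]
    exact hdet.ne_zero
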